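/- Let $n\ge 1$, let $\mathbb{D}^n=\{z\in\mathbb{C}^n: |z_1|<1,\dots,|z_n|<1\}$ be the unit polydisk, and let $F^{(1)},\dots,F^{(m)}:\mathbb{C}^n\to\mathbb{C}^n$ be polynomial vector fields. Consider the switched system $\dot z=F^{(\sigma)}(z)$, where the commutation law $\sigma:[0,\infty)\to\{1,\dots,m\}$ is any piecewise constant function with finitely many discontinuities on every bounded interval. *Assumptions.* 1. The origin is a common hyperbolic stable equilibrium: for all $i$, $F^{(i)}(0)=0$ and all eigenvalues of the Jacobian matrix $JF^{(i)}(0)$ have negative real part; and for each $i$ the origin is globally asymptotically stable on $\mathbb{D}^n$ for $\dot z=F^{(i)}(z)$. 2. The complex Lie algebra of matrices generated by $JF^{(1)}(0),\dots,JF^{(m)}(0)$ is solvable. 3. $\mathbb{D}^n$ is forward invariant for the flow of each $F^{(i)}$. *Notation.* Let $(\alpha(k))_{k\ge 0}$ enumerate $\mathbb{N}^n$ so that $\alpha(k)$ precedes $\alpha(j)$ if $|\alpha(k)|<|\alpha(j)|$, or if $|\alpha(k)|=|\alpha(j)|$ and $\alpha_l(k)>\alpha_l(j)$ for the smallest $l$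 with $\alpha_l(k)\ne\alpha_l(j)$; put $e_k(z)=z^{\alpha(k)}$. Let $\langle f,g\rangle=\int_{(\partial\mathbb{D})^n} f\,\bar g\,dm_n$ be the inner product of the Hardy space $\mathbb{H}^2(\mathbb{D}^n)$ ($m_n$ is the normalized Lebesgue measure on $(\partial\mathbb{D})^n$), and for a polynomial vector field $G$ let $L_G f=G\cdot\nabla f$ be its Koopman generator. For an invertible matrix $P$ put $\widehat F^{(i)}(\widehat z)=P^{-1}F^{(i)}(P\widehat z)$, and let $\widehat K^{(i)}$ be the number of pairs $(l,\beta)$, $1\le l\le n$, $\beta\in\mathbb{N}^n$, such that $\widehat z^{\,\beta}\neq \widehat z_l$ and the coefficient of $\widehat z^{\,\beta}$ in the component $\widehat F^{(i)}_l$ is nonzero. *Conclusion.* There is an invertible matrix $P$ with $\|P^{-1}\|_\infty=1$ (the matrix norm induced by the supremum norm) such that all matrices $P^{-1}JF^{(i)}(0)P$, $i=1,\dots,m$, are upper triangular. Moreover, for every such $P$: if $$\max_{i=1,\dots,m}\ \limsup_{j\to\infty}\ \max_{1\le k\le j-1}\ \frac{(\widehat K^{(i)})^2\,\bigl|\langle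 L_{\widehat F^{(i)}}e_k,e_j\rangle\bigr|^2}{\bigl|\Re\langle L_{\widehat F^{(i)}}e_j,e_j\rangle\bigr|\,\bigl|\Re\langle L_{\widehat F^{(i)}}e_k,e_k\rangle\bigr|}<1,$$ then the switched system is globally uniformly asymptotically stable (GUAS) on $\mathbb{D}^n$, that is: for every commutation law $\sigma$ and every $z_0\in\mathbb{D}^n$ there is a trajectory $z:[0,\infty)\to\mathbb{C}^n$ with $z(0)=z_0$; for every $\epsilon>0$ there is $\delta>0$ such that, for all $\sigma$ and all trajectories, $\|z(0)\|\le\delta$ implies $\|z(t)\|\le\epsilon$ for all $t>0$ and $\lim_{t\to\infty}z(t)=0$; and, for all $\sigma$ and all trajectories, $z(0)\in\mathbb{D}^n$ implies $\lim_{t\to\infty}z(t)=0$. -/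

import Mathlib

open Filter Topology MeasureTheory

noncomputable section

/-! ### Solutions of differential equations and of switched systems -/

section Dynamics

variable {E : Type*} [NormedAddCommGroup E] [NormedSpace ℝ E]

/-- `x` is a solution on `[0, ∞)` of the differential equation `ẋ = f(x)`. -/
def IsSolution (f : E → E) (x : ℝ → E) : Prop :=
  ∀ t : ℝ, 0 ≤ t → HasDerivWithinAt x (f (x t)) (Set.Ici 0) t

/-- `D` is forward invariant for the flow of `f`: solutions that start in `D` stay in `D`. -/
def IsInvariantForward (f : E → E) (D : Set E) : Prop :=
  ∀ x : ℝ → E, IsSolution f x → x 0 ∈ D → ∀ t : ℝ, 0 ≤ t → x t ∈ D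

/-- The equilibrium `xe` of `ẋ = f(x)` is globally asymptotically stable on `D`: solutions
starting in `D` exist for all nonnegative times, `xe` is Lyapunov stable, and all solutions that
start near `xe` or in `D` converge to `xe`. -/
structure IsGloballyAsymptoticallyStable (f : E → E) (xe : E) (D : Set E) : Prop where
  equilibrium : f xe = 0
  complete : ∀ x₀ ∈ D, ∃ x : ℝ → E, IsSolution f x ∧ x 0 = x₀
  stable : ∀ ε > 0, ∃ δ > 0,
    (∀ x : ℝ → E, IsSolution f x → ‖x 0 - xe‖ ≤ δ → ∀ t > 0, ‖x t - xe‖ ≤ ε) ∧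
    (∀ x : ℝ → E, IsSolution f x → ‖x 0 - xe‖ ≤ δ → Tendsto x atTop (𝓝 xe))
  attractive : ∀ x : ℝ → E, IsSolution f x → x 0 ∈ D → Tendsto x atTop (𝓝 xe)

variable {ι : Type*}

/-- `σ` does not switch at time `t`: it is constant in a neighbourhood of `t`. -/
def IsConstantNear (σ : ℝ → ι) (t : ℝ) : Prop :=
  ∀ᶠ s in 𝓝 t, σ s = σ t

/-- A commutation law: a piecewise constant function of time `t ≥ 0` with finitely many
discontinuities on every bounded time interval (the values at negative times play no role). -/
def IsCommutationLaw (σ : ℝ → ι) : Prop :=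
  ∀ T : ℝ, {t : ℝ | 0 < t ∧ t ≤ T ∧ ¬ IsConstantNear σ t}.Finite

/-- `x` is a trajectory on `[0, ∞)` of the switched system `ẋ = F^{(σ)}(x)`: it is continuous, and
between the switching times it solves the equation of the active subsystem. -/
def IsTrajectory (F : ι → E → E) (σ : ℝ → ι) (x : ℝ → E) : Prop :=
  ContinuousOn x (Set.Ici 0) ∧
    ∀ t : ℝ, 0 < t → IsConstantNear σ t → HasDerivAt x (F (σ t) (x t)) t

/-- The common equilibrium `xe` of the subsystems is uniformly asymptotically stable (UAS). -/
def IsUAS (F : ι → E → E) (xe : E) : Prop :=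
  ∀ ε > 0, ∃ δ > 0,
    (∀ (σ : ℝ → ι) (x : ℝ → E), IsCommutationLaw σ → IsTrajectory F σ x →
      ‖x 0 - xe‖ ≤ δ → ∀ t > 0, ‖x t - xe‖ ≤ ε) ∧
    (∀ (σ : ℝ → ι) (x : ℝ → E), IsCommutationLaw σ → IsTrajectory F σ x →
      ‖x 0 - xe‖ ≤ δ → Tendsto x atTop (𝓝 xe))

/-- The common equilibrium `xe` of the subsystems is globally uniformly asymptotically stable
(GUAS) on `D`. The clause `complete` makes explicit that, for every commutation law and every
initial state in `D`, there is a trajectory defined for all nonnegative times. -/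
structure IsGUAS (F : ι → E → E) (xe : E) (D : Set E) : Prop where
  equilibrium : ∀ i, F i xe = 0
  complete : ∀ (σ : ℝ → ι), IsCommutationLaw σ → ∀ x₀ ∈ D,
    ∃ x : ℝ → E, IsTrajectory F σ x ∧ x 0 = x₀
  uas : IsUAS F xe
  attractive : ∀ (σ : ℝ → ι) (x : ℝ → E), IsCommutationLaw σ → IsTrajectory F σ x →
    x 0 ∈ D → Tendsto x atTop (𝓝 xe)

end Dynamics

/-! ### The enumeration of the monomials -/

section Monomials

variable {n : ℕ}

/-- The order on multi-indices: first by total degree, and within one total degree the multi-index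
with the larger entry at the first place of difference comes first
(so `z₁ < z₂ < ⋯ < zₙ < z₁² < z₁z₂ < ⋯`). -/
def MultiIndexLT (β γ : Fin n →₀ ℕ) : Prop :=
  β.degree < γ.degree ∨
    (β.degree = γ.degree ∧ ∃ l, (∀ i < l, β i = γ i) ∧ γ l < β l)

theorem MultiIndexLT.irrefl (β : Fin n →₀ ℕ) : ¬ MultiIndexLT β β := by
  rintro (h | ⟨_, l, _, h⟩) <;> exact lt_irrefl _ h

theorem MultiIndexLT.trans {β γ δ : Fin n →₀ ℕ} (h₁ : MultiIndexLT β γ)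
    (h₂ : MultiIndexLT γ δ) : MultiIndexLT β δ := by
  rcases h₁ with h₁ | ⟨e₁, l, hl, h₁⟩ <;> rcases h₂ with h₂ | ⟨e₂, k, hk, h₂⟩
  · exact Or.inl (h₁.trans h₂)
  · exact Or.inl (e₂ ▸ h₁)
  · exact Or.inl (e₁ ▸ h₂)
  · refine Or.inr ⟨e₁.trans e₂, ?_⟩
    rcases lt_trichotomy l k with h | h | h
    · exact ⟨l, fun i hi => (hl i hi).trans (hk i (hi.trans h)), (hk l h) ▸ h₁⟩
    · subst h
      exact ⟨l, fun i hi => (hl i hi).trans (hk i hi), h₂.trans h₁⟩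
    · exact ⟨k, fun i hi => (hl i (hi.trans h)).trans (hk i hi), (hl k h) ▸ h₂⟩

theorem MultiIndexLT.total {β γ : Fin n →₀ ℕ} (h : β ≠ γ) :
    MultiIndexLT β γ ∨ MultiIndexLT γ β := by
  rcases lt_trichotomy β.degree γ.degree with hd | hd | hd
  · exact Or.inl (Or.inl hd)
  · classical
    have hne : (Finset.univ.filter fun l => β l ≠ γ l).Nonempty := by
      by_contra hc
      apply h
      ext l
      by_contra hl
      exact hc ⟨l, by simpa using hl⟩
    have hm := Finset.min'_mem _ hne
    have hmin : ∀ i < Finset.min' _ hne, β i = γ i := by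
      intro i hi
      by_contra hc
      exact absurd (Finset.min'_le _ i (by simpa using hc)) (not_le.mpr hi)
    have hm' : β (Finset.min' _ hne) ≠ γ (Finset.min' _ hne) := by simpa using hm
    rcases lt_or_gt_of_ne hm' with hl | hl
    · exact Or.inr (Or.inr ⟨hd.symm, _, fun i hi => (hmin i hi).symm, hl⟩)
    · exact Or.inl (Or.inr ⟨hd, _, hmin, hl⟩)
  · exact Or.inr (Or.inl hd)

theorem MultiIndexLT.finite_setOf (γ : Fin n →₀ ℕ) : {β | MultiIndexLT β γ}.Finite := by
  refine (Finsupp.finite_of_degree_le γ.degree).subset ?_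
  rintro β (h | ⟨h, _⟩)
  · exact h.le
  · exact h.le

/-- The position of a multi-index in the enumeration: the number of its predecessors. -/
def multiIndexRank (γ : Fin n →₀ ℕ) : ℕ :=
  {β | MultiIndexLT β γ}.ncard

theorem multiIndexRank_lt {β γ : Fin n →₀ ℕ} (h : MultiIndexLT β γ) :
    multiIndexRank β < multiIndexRank γ :=
  Set.ncard_lt_ncard ⟨fun _ hδ => MultiIndexLT.trans hδ h,
    fun hs => MultiIndexLT.irrefl β (hs h)⟩ (MultiIndexLT.finite_setOf γ)

theorem multiIndexRank_injective :
    Function.Injective (multiIndexRank : (Fin n →₀ ℕ) → ℕ) := by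
  intro β γ h
  by_contra hne
  rcases MultiIndexLT.total hne with h' | h'
  · exact absurd h (multiIndexRank_lt h').ne
  · exact absurd h (multiIndexRank_lt h').ne'

theorem multiIndexRank_bijective [NeZero n] :
    Function.Bijective (multiIndexRank : (Fin n →₀ ℕ) → ℕ) := by
  refine ⟨multiIndexRank_injective, fun k => ?_⟩
  have : Infinite (Fin n →₀ ℕ) :=
    Infinite.of_injective (fun a : ℕ => Finsupp.single (0 : Fin n) a)
      (Finsupp.single_injective 0)
  obtain ⟨_, ⟨γ, rfl⟩, hγ⟩ :=
    (Set.infinite_range_of_injective (multiIndexRank_injective (n := n))).exists_gt k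
  have hsub : multiIndexRank '' {β | MultiIndexLT β γ} ⊆ Set.Iio (multiIndexRank γ) := by
    rintro _ ⟨β, hβ, rfl⟩
    exact multiIndexRank_lt hβ
  have heq := Set.eq_of_subset_of_ncard_le hsub (by
    rw [Set.ncard_image_of_injective _ multiIndexRank_injective]
    simp [Set.ncard_eq_toFinset_card', multiIndexRank]) (Set.finite_Iio _)
  obtain ⟨β, _, hβ⟩ := heq.symm ▸ (show k ∈ Set.Iio (multiIndexRank γ) from hγ)
  exact ⟨β, hβ⟩

/-- The enumeration `k ↦ α(k)` of the multi-indices in increasing order, with `α(0) = 0`. -/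
def multiIndex (n : ℕ) [NeZero n] : ℕ ≃ (Fin n →₀ ℕ) :=
  (Equiv.ofBijective _ multiIndexRank_bijective).symm

theorem multiIndex_lt_iff [NeZero n] {j k : ℕ} :
    MultiIndexLT (multiIndex n k) (multiIndex n j) ↔ k < j := by
  have hr : ∀ i, multiIndexRank (multiIndex n i) = i := fun i =>
    (Equiv.ofBijective _ multiIndexRank_bijective).apply_symm_apply i
  refine ⟨fun h => by simpa only [hr] using multiIndexRank_lt h, fun h => ?_⟩
  have hne : multiIndex n k ≠ multiIndex n j := fun he => h.ne ((multiIndex n).injective he)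
  rcases MultiIndexLT.total hne with h' | h'
  · exact h'
  · exact absurd (by simpa only [hr] using multiIndexRank_lt h') (not_lt.mpr h.le)

/-- The monomial function `e_k(z) = z^{α(k)}` on `ℂⁿ`. -/
def monomialFun [NeZero n] (k : ℕ) (z : Fin n → ℂ) : ℂ :=
  ∏ l, z l ^ multiIndex n k l

end Monomials

/-! ### The polydisk, the Hardy inner product and the Koopman generator -/

section Koopman

variable {n : ℕ}

/-- The polydisk `𝔻ⁿ(0, ρ)`. -/
def polydisk (n : ℕ) (ρ : ℝ) : Set (Fin n → ℂ) :=
  {z | ∀ l, ‖z l‖ < ρ}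

/-- The inner product `⟨f, g⟩ = ∫ f(ω) conj (g(ω)) dm(ω)` of the Hardy space on the unit polydisk,
for functions given up to the distinguished boundary (such as polynomials); `m` is the normalized
Lebesgue measure on the torus `(∂𝔻)ⁿ`, parametrized by `ω_l = exp(2πi t_l)`. -/
def hardyInner (f g : (Fin n → ℂ) → ℂ) : ℂ :=
  ∫ t : Fin n → UnitAddCircle,
    f (fun l => (AddCircle.toCircle (t l) : ℂ)) *
      (starRingEnd ℂ) (g (fun l => (AddCircle.toCircle (t l) : ℂ)))
    ∂(Measure.pi fun _ => (AddCircle.haarAddCircle : Measure UnitAddCircle))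

/-- The Koopman generator `L_F f = F · ∇f`. -/
def koopmanGenerator (F : (Fin n → ℂ) → (Fin n → ℂ)) (f : (Fin n → ℂ) → ℂ) :
    (Fin n → ℂ) → ℂ :=
  fun z => fderiv ℂ f z (F z)

/-- The entry `⟨L_F e_k, e_j⟩` of the Koopman matrix. -/
def koopmanEntry [NeZero n] (F : (Fin n → ℂ) → (Fin n → ℂ)) (k j : ℕ) : ℂ :=
  hardyInner (koopmanGenerator F (monomialFun k)) (monomialFun j)

end Koopman

/-! ### Polynomial vector fields -/

section Polynomial

variable {n : ℕ}

/-- The vector field on `ℂⁿ` with polynomial components `F_l`. -/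
def polyField (F : Fin n → MvPolynomial (Fin n) ℂ) (z : Fin n → ℂ) : Fin n → ℂ :=
  fun l => MvPolynomial.eval z (F l)

/-- The Jacobian matrix `JF(0)`. -/
def jacobianZero (F : Fin n → MvPolynomial (Fin n) ℂ) : Matrix (Fin n) (Fin n) ℂ :=
  Matrix.of fun l q => MvPolynomial.eval 0 (MvPolynomial.pderiv q (F l))

/-- `0` is a hyperbolic stable equilibrium: `F(0) = 0` and every eigenvalue of `JF(0)` has
negative real part. -/
def IsHyperbolicStableZero (F : Fin n → MvPolynomial (Fin n) ℂ) : Prop :=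
  polyField F 0 = 0 ∧
    ∀ μ : ℂ, Module.End.HasEigenvalue (Matrix.toLin' (jacobianZero F)) μ → μ.re < 0

/-- The vector field `F̂(ẑ) = P⁻¹ F(P ẑ)` in the coordinates `ẑ = P⁻¹ z`. -/
def changeCoords (P : Matrix (Fin n) (Fin n) ℂ) (F : Fin n → MvPolynomial (Fin n) ℂ) :
    Fin n → MvPolynomial (Fin n) ℂ :=
  fun l => ∑ q, MvPolynomial.C (P⁻¹ l q) *
    MvPolynomial.bind₁ (fun s => ∑ r, MvPolynomial.C (P s r) * MvPolynomial.X r) (F q)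

theorem polyField_changeCoords (P : Matrix (Fin n) (Fin n) ℂ)
    (F : Fin n → MvPolynomial (Fin n) ℂ) (z : Fin n → ℂ) :
    polyField (changeCoords P F) z = P⁻¹.mulVec (polyField F (P.mulVec z)) := by
  funext l
  simp only [polyField, changeCoords, map_sum, map_mul, MvPolynomial.eval_C, Matrix.mulVec,
    dotProduct]
  refine Finset.sum_congr rfl fun q _ => ?_
  congr 1
  rw [← MvPolynomial.coe_aeval_eq_eval, RingHom.coe_coe, MvPolynomial.aeval_bind₁]
  simp [MvPolynomial.aeval_eq_eval]
  rfl

/-- The number of nonzero terms of a polynomial vector field, where the monomial `z_l` in the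
component `F_l` is not counted. -/
def numTerms (F : Fin n → MvPolynomial (Fin n) ℂ) : ℕ :=
  ∑ l, ((F l).support.erase (Finsupp.single l 1)).card

/-- The matrix norm `‖A‖_∞` induced by the supremum norm of `ℂⁿ` (the maximal row sum). -/
def matrixSupNorm (A : Matrix (Fin n) (Fin n) ℂ) : ℝ :=
  letI := Matrix.linftyOpNormedAddCommGroup (m := Fin n) (n := Fin n) (α := ℂ)
  ‖A‖

section Solvable

attribute [local instance] LieRing.ofAssociativeRing

/-- The complex Lie algebra of matrices generated by the `A⁽ⁱ⁾`, with the commutator as bracket,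
is solvable. -/
def GeneratesSolvable {ι : Type*} (A : ι → Matrix (Fin n) (Fin n) ℂ) : Prop :=
  LieAlgebra.IsSolvable (LieSubalgebra.lieSpan ℂ (Matrix (Fin n) (Fin n) ℂ) (Set.range A))

end Solvable

/-- `P` is an invertible matrix, normalized by `‖P⁻¹‖_∞ = 1`, such that all the matrices
`P⁻¹ A⁽ⁱ⁾ P` are upper triangular. -/
structure IsTriangularizer {ι : Type*} (A : ι → Matrix (Fin n) (Fin n) ℂ)
    (P : Matrix (Fin n) (Fin n) ℂ) : Prop where
  isUnit_det : IsUnit P.det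
  norm_inv : matrixSupNorm P⁻¹ = 1
  upper : ∀ (i : ι) (l q : Fin n), q < l → (P⁻¹ * A i * P) l q = 0

/-- The quantity
`K² |⟨L_F e_k, e_j⟩|² / (|Re ⟨L_F e_j, e_j⟩| |Re ⟨L_F e_k, e_k⟩|)`, with `K` the number of nonzero
terms of `F`. -/
def couplingRatio [NeZero n] (F : Fin n → MvPolynomial (Fin n) ℂ) (j k : ℕ) : ℝ :=
  (numTerms F : ℝ) ^ 2 * ‖koopmanEntry (polyField F) k j‖ ^ 2 /
    (|(koopmanEntry (polyField F) j j).re| * |(koopmanEntry (polyField F) k k).re|)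

end Polynomial

end

/-! In the coordinates ẑ = P⁻¹z the Koopman matrix A_kj = ⟨L e_k, e_j⟩ of every subsystem is upper
triangular for the ordering of the monomials (`lt_of_koopmanEntry_ne_zero`), and each row and column
has at most K off-diagonal entries, K being the number of counted terms. This makes V = ∑_{k≥1} ε_k
|e_k|² a common Lyapunov function for suitable weights. In V' the diagonal contributes −2 ∑ ε_k |Re
A_kk| |e_k|², and AM–GM charges each off-diagonal term to the two diagonal terms it couples, so that
all couplings together absorb at most a fraction √q < 1 of the dissipation
(`sum_triangular_coupling_le`). As |Re A_kk| ≥ c > 0 for k ≥ 1, this gives V' ≤ −2(1 − √q)c V.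

The weights must satisfy ε_k ρ_jk ≤ q ε_j for k < j, where ρ is the coupling ratio. By the limsup
hypothesis constant weights do this for large j, and the finitely many other pairs are handled by
letting the weights grow up to a finite index (`exists_bounded_weights`). Thus 1 ≤ ε_k ≤ E, so V
converges on the whole open polydisk, dominates ‖ẑ‖² and tends to 0 at the origin.

The infinite series is never differentiated: its truncations satisfy the inequality up to an
arbitrarily small error (`eventually_lyapunovRate_le`), and Grönwall's inequality yields exponential
decay with a bound independent of the truncation (`norm_sq_le_of_isTriangularStable`). Forward
invariance and ‖P⁻¹‖ = 1 keep ẑ in the polydisk. The matrix P comes from Lie's theorem, and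
trajectories come from concatenating solutions of the subsystems. -/

noncomputable section

open Filter Topology MeasureTheory

/-! ### Orthonormality of the monomials on the torus. -/

section TorusIntegrals

/-- A nontrivial character changes sign under a suitable translation, which preserves the measure.
-/
theorem integral_fourier_haarAddCircle (k : ℤ) :
    ∫ t : UnitAddCircle, fourier k t ∂AddCircle.haarAddCircle = if k = 0 then 1 else 0 := by
  split_ifs with h
  · simp [h]
  · exact integral_eq_zero_of_add_right_eq_neg (μ := AddCircle.haarAddCircle)
      (fourier_add_half_inv_index h (by norm_num))

theorem hardyInner_prod_pow {n : ℕ} (β γ : Fin n →₀ ℕ) :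
    hardyInner (fun z => ∏ l, z l ^ β l) (fun z => ∏ l, z l ^ γ l) = if β = γ then 1 else 0 := by
  have h : ∀ t : Fin n → UnitAddCircle,
      (∏ l, (AddCircle.toCircle (t l) : ℂ) ^ β l) *
        (starRingEnd ℂ) (∏ l, (AddCircle.toCircle (t l) : ℂ) ^ γ l) =
      ∏ l, fourier ((β l : ℤ) - γ l) (t l) := by
    intro t
    rw [map_prod, ← Finset.prod_mul_distrib]
    refine Finset.prod_congr rfl fun l _ => ?_
    rw [sub_eq_add_neg, fourier_add, fourier_neg, map_pow]
    simp [fourier_apply, AddCircle.toCircle_nsmul]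
  unfold hardyInner
  simp_rw [h]
  rw [integral_fintype_prod_eq_prod (f := fun l t => (fourier ((β l : ℤ) - γ l) t : ℂ))]
  simp_rw [integral_fourier_haarAddCircle]
  split_ifs with hβ
  · simp [hβ]
  · obtain ⟨l, hl⟩ : ∃ l, β l ≠ γ l := by
      by_contra! hc
      exact hβ (Finsupp.ext hc)
    refine Finset.prod_eq_zero (Finset.mem_univ l) (if_neg ?_)
    omega

/-- Orthonormality makes the inner product extract a coefficient; from here on the Koopman entries
are handled algebraically. -/
theorem hardyInner_eval_monomialFun {n : ℕ} [NeZero n] (p : MvPolynomial (Fin n) ℂ) (j : ℕ) :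
    hardyInner (fun z => MvPolynomial.eval z p) (monomialFun j) = p.coeff (multiIndex n j) := by
  have hc : ∀ β : Fin n →₀ ℕ, Continuous fun t : Fin n → UnitAddCircle =>
      (∏ l, (AddCircle.toCircle (t l) : ℂ) ^ β l) *
        (starRingEnd ℂ) (∏ l, (AddCircle.toCircle (t l) : ℂ) ^ multiIndex n j l) := by
    intro β
    have : ∀ l : Fin n, Continuous fun t : Fin n → UnitAddCircle =>
        (AddCircle.toCircle (t l) : ℂ) := fun l =>
      continuous_subtype_val.comp (AddCircle.continuous_toCircle.comp (continuous_apply l))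
    refine Continuous.mul (by fun_prop) (Complex.continuous_conj.comp (by fun_prop))
  have h := fun β : Fin n →₀ ℕ => hardyInner_prod_pow β (multiIndex n j)
  unfold hardyInner at h ⊢
  simp_rw [MvPolynomial.eval_eq', monomialFun, Finset.sum_mul, mul_assoc]
  rw [integral_finsetSum]
  · simp_rw [integral_const_mul, h]
    simp +contextual [eq_comm]
  · intro β _
    exact ((hc β).integrable_of_hasCompactSupport
      (HasCompactSupport.of_compactSpace _)).const_mul _

end TorusIntegrals

/-! ### Derivatives and Jacobians of polynomial vector fields. -/

section PolynomialDerivatives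

variable {n : ℕ}

theorem MvPolynomial.hasFDerivAt_eval (p : MvPolynomial (Fin n) ℂ) (z : Fin n → ℂ) :
    HasFDerivAt (fun w => MvPolynomial.eval w p)
      (∑ q, MvPolynomial.eval z (MvPolynomial.pderiv q p) •
        ContinuousLinearMap.proj (R := ℂ) (φ := fun _ : Fin n => ℂ) q) z := by
  classical
  induction p using MvPolynomial.induction_on with
  | C a =>
    simp only [MvPolynomial.eval_C]
    refine (hasFDerivAt_const a z).congr_fderiv ?_
    ext v
    simp
  | add p q hp hq =>
    simp only [map_add]
    refine (hp.add hq).congr_fderiv ?_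
    ext v
    simp [add_mul, Finset.sum_add_distrib]
  | mul_X p i hp =>
    have := hp.mul (hasFDerivAt_apply (𝕜 := ℂ) (F' := fun _ : Fin n => ℂ) i z)
    simp only [map_mul, MvPolynomial.eval_X]
    refine this.congr_fderiv ?_
    ext v
    simp only [Derivation.leibniz, MvPolynomial.pderiv_X, smul_eq_mul, map_add, map_mul,
      MvPolynomial.eval_X, add_apply, smul_apply,
      sum_apply, ContinuousLinearMap.proj_apply, add_mul,
      Finset.sum_add_distrib, Finset.mul_sum]
    congr 1
    · simp [Pi.single_apply, apply_ite]
    · simp [mul_assoc]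

theorem hasFDerivAt_polyField (F : Fin n → MvPolynomial (Fin n) ℂ) (z : Fin n → ℂ) :
    HasFDerivAt (polyField F) (ContinuousLinearMap.pi fun l =>
      ∑ q, MvPolynomial.eval z (MvPolynomial.pderiv q (F l)) •
        ContinuousLinearMap.proj (R := ℂ) (φ := fun _ : Fin n => ℂ) q) z :=
  hasFDerivAt_pi.2 fun l => (F l).hasFDerivAt_eval z

theorem hasFDerivAt_polyField_zero (F : Fin n → MvPolynomial (Fin n) ℂ) :
    HasFDerivAt (polyField F) (LinearMap.toContinuousLinearMap (jacobianZero F).mulVecLin) 0 := by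
  refine (hasFDerivAt_polyField F 0).congr_fderiv ?_
  ext v l
  simp [jacobianZero, Matrix.mulVec, dotProduct]

/-- Chain rule and uniqueness of the derivative, which avoids expanding the substituted polynomials.
-/
theorem jacobianZero_changeCoords (P : Matrix (Fin n) (Fin n) ℂ)
    (F : Fin n → MvPolynomial (Fin n) ℂ) :
    jacobianZero (changeCoords P F) = P⁻¹ * jacobianZero F * P := by
  have h1 := hasFDerivAt_polyField_zero (changeCoords P F)
  have h2 : HasFDerivAt (polyField (changeCoords P F))
      (LinearMap.toContinuousLinearMap (P⁻¹ * jacobianZero F * P).mulVecLin) 0 := by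
    have hP : ∀ (Q : Matrix (Fin n) (Fin n) ℂ) (z), HasFDerivAt (fun z => Q.mulVec z)
        (LinearMap.toContinuousLinearMap Q.mulVecLin) z := fun Q z =>
      (LinearMap.toContinuousLinearMap Q.mulVecLin).hasFDerivAt
    have hF := hasFDerivAt_polyField_zero F
    rw [← P.mulVec_zero] at hF
    have := (hP P⁻¹ _).comp 0 (hF.comp 0 (hP P 0))
    rw [show polyField (changeCoords P F) = fun z => P⁻¹.mulVec (polyField F (P.mulVec z)) from
      funext (polyField_changeCoords P F)]
    refine this.congr_fderiv ?_
    ext v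
    simp [Matrix.mulVec_mulVec, Matrix.mul_assoc]
  have h3 := congrArg ContinuousLinearMap.toLinearMap (h1.unique h2)
  simp only [LinearMap.coe_toContinuousLinearMap] at h3
  exact Matrix.mulVec_injective (funext fun v => congrArg (fun g => g v) h3)

theorem coeff_single_eq_jacobianZero (F : Fin n → MvPolynomial (Fin n) ℂ) (l q : Fin n) :
    (F l).coeff (Finsupp.single q 1) = jacobianZero F l q := by
  rw [jacobianZero, Matrix.of_apply, MvPolynomial.eval_zero, MvPolynomial.constantCoeff_eq,
    MvPolynomial.coeff_pderiv]
  simp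

theorem coeff_zero_eq_zero_of_polyField (F : Fin n → MvPolynomial (Fin n) ℂ)
    (h : polyField F 0 = 0) (l : Fin n) : (F l).coeff 0 = 0 := by
  have := congrFun h l
  simpa [polyField, MvPolynomial.constantCoeff_eq] using this

end PolynomialDerivatives

/-! ### Koopman entries as polynomial coefficients. -/

section KoopmanPolynomial

variable {n : ℕ} [NeZero n]

/-- The polynomial `L_F e_k`. -/
def koopmanPoly (F : Fin n → MvPolynomial (Fin n) ℂ) (k : ℕ) : MvPolynomial (Fin n) ℂ :=
  ∑ l, MvPolynomial.pderiv l (MvPolynomial.monomial (multiIndex n k) 1) * F l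

theorem monomialFun_eq_eval (k : ℕ) (z : Fin n → ℂ) :
    monomialFun k z = MvPolynomial.eval z (MvPolynomial.monomial (multiIndex n k) 1) := by
  simp [monomialFun, MvPolynomial.eval_monomial, Finsupp.prod_fintype]

theorem hasFDerivAt_monomialFun (k : ℕ) (z : Fin n → ℂ) :
    HasFDerivAt (monomialFun k) (∑ q,
      MvPolynomial.eval z (MvPolynomial.pderiv q (MvPolynomial.monomial (multiIndex n k) 1)) •
        ContinuousLinearMap.proj (R := ℂ) (φ := fun _ : Fin n => ℂ) q) z := by
  rw [show monomialFun k = _ from funext (monomialFun_eq_eval (n := n) k)]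
  exact MvPolynomial.hasFDerivAt_eval _ z

theorem koopmanGenerator_monomialFun (F : Fin n → MvPolynomial (Fin n) ℂ) (k : ℕ) :
    koopmanGenerator (polyField F) (monomialFun k) =
      fun z => MvPolynomial.eval z (koopmanPoly F k) := by
  funext z
  rw [koopmanGenerator, (hasFDerivAt_monomialFun k z).fderiv]
  simp [koopmanPoly, polyField]

theorem koopmanEntry_eq_coeff (F : Fin n → MvPolynomial (Fin n) ℂ) (k j : ℕ) :
    koopmanEntry (polyField F) k j = (koopmanPoly F k).coeff (multiIndex n j) := by
  rw [koopmanEntry, koopmanGenerator_monomialFun, hardyInner_eval_monomialFun]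

theorem koopmanGenerator_monomialFun_eq_sum (F : Fin n → MvPolynomial (Fin n) ℂ) (k : ℕ) :
    ∃ M₀, ∀ M ≥ M₀, ∀ z, koopmanGenerator (polyField F) (monomialFun k) z =
      ∑ j ∈ Finset.range M, koopmanEntry (polyField F) k j * monomialFun j z := by
  classical
  let S := (koopmanPoly F k).support.map (multiIndex n).symm.toEmbedding
  obtain ⟨M₀, hM₀⟩ := S.exists_nat_subset_range
  refine ⟨M₀, fun M hM z => ?_⟩
  rw [koopmanGenerator_monomialFun]
  simp only [koopmanEntry_eq_coeff]
  rw [← Finset.sum_subset (hM₀.trans (Finset.range_mono hM)), MvPolynomial.eval_eq', Finset.sum_map]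
  · simp [monomialFun]
  · intro j _ hj
    have : multiIndex n j ∉ (koopmanPoly F k).support := fun h =>
      hj (Finset.mem_map.2 ⟨_, h, by simp⟩)
    rw [MvPolynomial.notMem_support_iff.1 this, zero_mul]

end KoopmanPolynomial

/-! ### Sparsity and triangularity of the Koopman matrix. -/

section KoopmanMatrix

variable {n : ℕ} [NeZero n] {F : Fin n → MvPolynomial (Fin n) ℂ}

theorem koopmanEntry_eq_sum (F : Fin n → MvPolynomial (Fin n) ℂ) (k j : ℕ) :
    koopmanEntry (polyField F) k j = ∑ l,
      if multiIndex n k - Finsupp.single l 1 ≤ multiIndex n j then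
        (multiIndex n k l : ℂ) *
          (F l).coeff (multiIndex n j - (multiIndex n k - Finsupp.single l 1))
      else 0 := by
  rw [koopmanEntry_eq_coeff, koopmanPoly, MvPolynomial.coeff_sum]
  refine Finset.sum_congr rfl fun l _ => ?_
  rw [MvPolynomial.pderiv_monomial, MvPolynomial.coeff_monomial_mul', one_mul]

/-- A term z^β of F_l sends z^α to a multiple of z^(α+β−e_l). Written without truncated subtraction,
this relation yields both triangularity and the sparsity counts. -/
theorem exists_of_koopmanEntry_ne_zero {k j : ℕ} (h : koopmanEntry (polyField F) k j ≠ 0) :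
    ∃ l, ∃ β ∈ (F l).support, multiIndex n k l ≠ 0 ∧
      multiIndex n j + Finsupp.single l 1 = multiIndex n k + β := by
  rw [koopmanEntry_eq_sum] at h
  obtain ⟨l, _, hl⟩ := Finset.exists_ne_zero_of_sum_ne_zero h
  split_ifs at hl with hle
  · have hk : multiIndex n k l ≠ 0 := by
      intro h0
      simp [h0] at hl
    refine ⟨l, _, MvPolynomial.mem_support_iff.2 (right_ne_zero_of_mul hl), hk, ?_⟩
    have hs : Finsupp.single l 1 ≤ multiIndex n k := by
      simpa [Nat.one_le_iff_ne_zero] using hk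
    calc multiIndex n j + Finsupp.single l 1
        = (multiIndex n k - Finsupp.single l 1) +
          (multiIndex n j - (multiIndex n k - Finsupp.single l 1)) + Finsupp.single l 1 := by
          rw [add_tsub_cancel_of_le hle]
      _ = (multiIndex n k - Finsupp.single l 1) + Finsupp.single l 1 +
          (multiIndex n j - (multiIndex n k - Finsupp.single l 1)) := add_right_comm _ _ _
      _ = _ := by rw [tsub_add_cancel_of_le hs]
  · exact absurd rfl hl

theorem koopmanEntry_self (F : Fin n → MvPolynomial (Fin n) ℂ) (k : ℕ) :
    koopmanEntry (polyField F) k k = ∑ l, (multiIndex n k l : ℂ) * jacobianZero F l l := by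
  rw [koopmanEntry_eq_sum]
  refine Finset.sum_congr rfl fun l _ => ?_
  rw [if_pos tsub_le_self]
  rcases eq_or_ne (multiIndex n k l) 0 with h | h
  · simp [h]
  -- Since α_l(k) ≥ 1 here, the truncated difference α(k) − (α(k) − e_l) really is e_l.
  · rw [tsub_tsub_cancel_of_le (by simpa [Nat.one_le_iff_ne_zero] using h),
      coeff_single_eq_jacobianZero]

/-- As F(0) = 0, every term has |β| ≥ 1. If |β| > 1 the degree rises; if β = e_q, triangularity of
the linear part gives l ≤ q, and for l < q one unit moves from place l to a later place, which is a
later multi-index of the same degree. -/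
theorem lt_of_koopmanEntry_ne_zero (h0 : polyField F 0 = 0)
    (hup : ∀ l q, q < l → jacobianZero F l q = 0) {k j : ℕ}
    (h : koopmanEntry (polyField F) k j ≠ 0) (hkj : k ≠ j) : k < j := by
  obtain ⟨l, β, hβ, -, he⟩ := exists_of_koopmanEntry_ne_zero h
  rw [MvPolynomial.mem_support_iff] at hβ
  rw [← multiIndex_lt_iff (n := n)]
  have hd := congrArg Finsupp.degree he
  simp only [map_add, Finsupp.degree_single] at hd
  have hβ0 : β ≠ 0 := by
    rintro rfl
    exact hβ (coeff_zero_eq_zero_of_polyField F h0 l)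
  have hβd : β.degree ≠ 0 := by simpa [Finsupp.degree_eq_zero_iff] using hβ0
  rcases Nat.lt_or_ge 1 β.degree with h2 | h2
  · exact Or.inl (by omega)
  · obtain ⟨q, rfl⟩ : ∃ q, β = Finsupp.single q 1 := by
      obtain ⟨q, hq⟩ := Finsupp.ne_iff.1 hβ0
      have hle : Finsupp.single q 1 ≤ β := by simpa [Nat.one_le_iff_ne_zero] using hq
      obtain ⟨γ, rfl⟩ := exists_add_of_le hle
      rw [map_add, Finsupp.degree_single] at h2
      exact ⟨q, by rw [(Finsupp.degree_eq_zero_iff γ).1 (by omega), add_zero]⟩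
    rw [coeff_single_eq_jacobianZero] at hβ
    have hlq : l ≤ q := by
      by_contra! hc
      exact hβ (hup l q hc)
    rcases hlq.eq_or_lt with rfl | hlq
    · exact absurd ((multiIndex n).injective (add_right_cancel he)).symm hkj
    · refine Or.inr ⟨by simp at hd; omega, l, fun i hi => ?_, ?_⟩
      · have := DFunLike.congr_fun he i
        simpa [Finsupp.single_apply, hi.ne', (hi.trans hlq).ne'] using this.symm
      · have := DFunLike.congr_fun he l
        simp [hlq.ne'] at this
        omega

/-- Given k, the term (l, β) determines j. The uncounted terms β = e_l only produce j = k. -/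
theorem card_row_le_numTerms (F : Fin n → MvPolynomial (Fin n) ℂ) (k : ℕ) (s : Finset ℕ) :
    (s.filter fun j => k ≠ j ∧ koopmanEntry (polyField F) k j ≠ 0).card ≤ numTerms F := by
  rw [numTerms, ← Finset.card_sigma]
  refine Finset.card_le_card_of_forall_subsingleton
    (fun j b => multiIndex n j + Finsupp.single b.1 1 = multiIndex n k + b.2) ?_ ?_
  · intro j hj
    obtain ⟨hkj, hne⟩ := (Finset.mem_filter.1 hj).2
    obtain ⟨l, β, hβ, -, he⟩ := exists_of_koopmanEntry_ne_zero hne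
    refine ⟨⟨l, β⟩, ?_, he⟩
    simp only [Finset.mem_sigma, Finset.mem_univ, true_and, Finset.mem_erase]
    refine ⟨?_, hβ⟩
    rintro rfl
    exact hkj ((multiIndex n).injective (add_right_cancel he)).symm
  · rintro b - j ⟨-, hj⟩ j' ⟨-, hj'⟩
    exact (multiIndex n).injective (add_right_cancel (hj.trans hj'.symm))

theorem card_column_le_numTerms (F : Fin n → MvPolynomial (Fin n) ℂ) (j : ℕ) (s : Finset ℕ) :
    (s.filter fun k => k ≠ j ∧ koopmanEntry (polyField F) k j ≠ 0).card ≤ numTerms F := by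
  rw [numTerms, ← Finset.card_sigma]
  refine Finset.card_le_card_of_forall_subsingleton
    (fun k b => multiIndex n j + Finsupp.single b.1 1 = multiIndex n k + b.2) ?_ ?_
  · intro k hk
    obtain ⟨hkj, hne⟩ := (Finset.mem_filter.1 hk).2
    obtain ⟨l, β, hβ, -, he⟩ := exists_of_koopmanEntry_ne_zero hne
    refine ⟨⟨l, β⟩, ?_, he⟩
    simp only [Finset.mem_sigma, Finset.mem_univ, true_and, Finset.mem_erase]
    refine ⟨?_, hβ⟩
    rintro rfl
    exact hkj ((multiIndex n).injective (add_right_cancel he)).symm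
  · rintro b - k ⟨-, hk⟩ k' ⟨-, hk'⟩
    exact (multiIndex n).injective (add_right_cancel (hk.symm.trans hk'))

theorem multiIndex_zero : multiIndex n 0 = 0 := by
  by_contra h
  rcases MultiIndexLT.total (Ne.symm h) with h' | h'
  · obtain ⟨k, hk⟩ := (multiIndex n).surjective 0
    rw [← hk, multiIndex_lt_iff] at h'
    omega
  · rcases h' with h' | ⟨h', -⟩
    · simp at h'
    · exact h (by simpa [Finsupp.degree_eq_zero_iff] using h')

theorem degree_multiIndex_pos {k : ℕ} (hk : 1 ≤ k) : 1 ≤ (multiIndex n k).degree := by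
  rw [Nat.one_le_iff_ne_zero, Ne, Finsupp.degree_eq_zero_iff, ← multiIndex_zero]
  exact fun h => by have := (multiIndex n).injective h; omega

end KoopmanMatrix

/-! ### Diagonal entries of a triangularization are eigenvalues. -/

section TriangularEigenvalues

variable {n : ℕ}

theorem hasEigenvalue_conj_diag {A P : Matrix (Fin n) (Fin n) ℂ} (hP : IsUnit P.det)
    (hup : ∀ l q, q < l → (P⁻¹ * A * P) l q = 0) (l : Fin n) :
    Module.End.HasEigenvalue (Matrix.toLin' A) ((P⁻¹ * A * P) l l) := by
  set μ := (P⁻¹ * A * P) l l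
  have hdet : (P⁻¹ * A * P - Matrix.scalar (Fin n) μ).det = 0 := by
    rw [Matrix.det_of_isUpperTriangular]
    · exact Finset.prod_eq_zero (Finset.mem_univ l) (by simp [μ])
    · intro i j hij
      have hne : i ≠ j := ne_of_gt hij
      simp [hup i j hij, hne]
  have hconj : P⁻¹ * A * P - Matrix.scalar (Fin n) μ =
      P⁻¹ * (A - Matrix.scalar (Fin n) μ) * P := by
    have h1 : P⁻¹ * P = 1 := Matrix.nonsing_inv_mul P hP
    have : Matrix.scalar (Fin n) μ = μ • (1 : Matrix (Fin n) (Fin n) ℂ) := by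
      simp [Matrix.smul_one_eq_diagonal]
    rw [this, Matrix.mul_sub, Matrix.sub_mul, Matrix.mul_smul, Matrix.smul_mul, Matrix.mul_one, h1]
  rw [hconj, Matrix.det_mul, Matrix.det_mul, mul_assoc, mul_comm, mul_assoc, ← Matrix.det_mul,
    Matrix.mul_nonsing_inv P hP, Matrix.det_one, mul_one] at hdet
  obtain ⟨v, hv, hAv⟩ := Matrix.exists_mulVec_eq_zero_iff.2 hdet
  refine Module.End.hasEigenvalue_of_hasEigenvector (x := v) ⟨?_, hv⟩
  rw [Module.End.mem_eigenspace_iff, Matrix.toLin'_apply]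
  rw [Matrix.sub_mulVec, sub_eq_zero] at hAv
  rw [hAv]
  ext i
  simp [Matrix.mulVec_diagonal]

end TriangularEigenvalues

/-! ### Absorbing the off-diagonal couplings, and choosing the weights. -/

section WeightedSums

/-- AM–GM in the form 4uv ≤ (u + v)², with a = |A_kj|, R = |Re A| on the diagonal, x = |e_k| and y =
|e_j|. The factor 1/(2K) is chosen so that the at most K couplings in a row and K in a column cost
√q in total. -/
theorem coupling_term_le {K q εk εj a Rk Rj x y : ℝ} (hK : 0 < K) (hq : 0 ≤ q) (hεk : 0 ≤ εk)
    (hεj : 0 ≤ εj) (hRk : 0 < Rk) (hRj : 0 < Rj)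
    (h : εk * (K ^ 2 * a ^ 2 / (Rj * Rk)) ≤ q * εj) :
    εk * (a * y * x) ≤ √q / (2 * K) * (εk * Rk * x ^ 2 + εj * Rj * y ^ 2) := by
  have hR : 0 < Rj * Rk := mul_pos hRj hRk
  have h1 : εk * (K ^ 2 * a ^ 2) ≤ q * εj * (Rj * Rk) := by
    rw [← mul_div_assoc, div_le_iff₀ hR] at h
    exact h
  set u := εk * Rk * x ^ 2
  set v := εj * Rj * y ^ 2
  have hu : 0 ≤ u := by positivity
  have hv : 0 ≤ v := by positivity
  have h2 : (2 * K * (εk * (a * y * x))) ^ 2 ≤ (√q * (u + v)) ^ 2 := by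
    calc (2 * K * (εk * (a * y * x))) ^ 2
        = 4 * (εk * x ^ 2 * y ^ 2) * (εk * (K ^ 2 * a ^ 2)) := by ring
      _ ≤ 4 * (εk * x ^ 2 * y ^ 2) * (q * εj * (Rj * Rk)) := by gcongr
      _ = q * (4 * u * v) := by simp only [u, v]; ring
      _ ≤ q * (u + v) ^ 2 := by
        gcongr
        nlinarith [sq_nonneg (u - v)]
      _ = (√q * (u + v)) ^ 2 := by rw [mul_pow, Real.sq_sqrt hq]
  have h3 := abs_le_of_sq_le_sq' h2 (by positivity)
  rw [div_mul_eq_mul_div, le_div_iff₀ (by positivity)]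
  calc εk * (a * y * x) * (2 * K) = 2 * K * (εk * (a * y * x)) := by ring
    _ ≤ _ := h3.2

/-- An index k < N receives −1 from the diagonal, at most √q/2 from its row and at most √q/2 from
its column. An index j ≥ N lies outside the truncation and is charged only through its column, hence
the last sum. -/
theorem sum_triangular_coupling_le {A : ℕ → ℕ → ℂ} {K : ℕ} {ε : ℕ → ℝ} {q : ℝ}
    (hrow : ∀ k (s : Finset ℕ), (s.filter fun j => k ≠ j ∧ A k j ≠ 0).card ≤ K)
    (hcol : ∀ j (s : Finset ℕ), (s.filter fun k => k ≠ j ∧ A k j ≠ 0).card ≤ K)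
    (htri : ∀ k j, A k j ≠ 0 → k ≠ j → k < j) (hneg : ∀ k, 1 ≤ k → (A k k).re < 0)
    (hε : ∀ k, 0 ≤ ε k) (hq : 0 ≤ q)
    (hcpl : ∀ k j, 1 ≤ k → k < j →
      ε k * ((K : ℝ) ^ 2 * ‖A k j‖ ^ 2 / (|(A j j).re| * |(A k k).re|)) ≤ q * ε j)
    (e : ℕ → ℂ) {N M : ℕ} (hN : 1 ≤ N) (hNM : N ≤ M) :
    ∑ k ∈ Finset.Ico 1 N, ε k * ((starRingEnd ℂ) (e k) * ∑ j ∈ Finset.range M, A k j * e j).re ≤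
      -(1 - √q) * ∑ k ∈ Finset.Ico 1 N, ε k * |(A k k).re| * ‖e k‖ ^ 2 +
        √q / 2 * ∑ j ∈ Finset.Ico N M, ε j * |(A j j).re| * ‖e j‖ ^ 2 := by
  classical
  set w : ℕ → ℝ := fun k => ε k * |(A k k).re| * ‖e k‖ ^ 2 with hw
  have hw0 : ∀ k, 0 ≤ w k := fun k => by have := hε k; positivity
  set c : ℕ → ℕ → ℝ := fun k j => if k ≠ j ∧ A k j ≠ 0 then √q / (2 * K) else 0 with hc
  -- Only an inequality, because K may be 0.
  have hK : (K : ℝ) * (√q / (2 * K)) ≤ √q / 2 := by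
    rcases eq_or_ne (K : ℝ) 0 with h | h
    · rw [h, zero_mul]; positivity
    · exact le_of_eq (by field_simp)
  have hcrow : ∀ k s, ∑ j ∈ s, c k j ≤ √q / 2 := by
    intro k s
    rw [hc, ← Finset.sum_filter, Finset.sum_const, nsmul_eq_mul]
    refine le_trans ?_ hK
    gcongr
    exact hrow k s
  have hccol : ∀ j s, ∑ k ∈ s, c k j ≤ √q / 2 := by
    intro j s
    rw [hc, ← Finset.sum_filter, Finset.sum_const, nsmul_eq_mul]
    refine le_trans ?_ hK
    gcongr
    exact hcol j s
  have hterm : ∀ k j, 1 ≤ k → k ≠ j →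
      ε k * ((starRingEnd ℂ) (e k) * (A k j * e j)).re ≤ c k j * (w k + w j) := by
    intro k j hk hkj
    rcases eq_or_ne (A k j) 0 with h0 | h0
    · simp [hc, h0]
    · have hlt := htri k j h0 hkj
      have hK1 : 1 ≤ K := by
        refine le_trans ?_ (hrow k {j})
        rw [Finset.filter_singleton, if_pos ⟨hkj, h0⟩, Finset.card_singleton]
      simp only [hc, if_pos (And.intro hkj h0)]
      refine le_trans ?_ (coupling_term_le (K := K) (by exact_mod_cast hK1) hq (hε k) (hε j)
        (abs_pos.2 (hneg k hk).ne) (abs_pos.2 (hneg j (by omega)).ne) (x := ‖e k‖) (y := ‖e j‖)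
        (hcpl k j hk hlt))
      refine mul_le_mul_of_nonneg_left ((Complex.re_le_norm _).trans_eq ?_) (hε k)
      rw [norm_mul, norm_mul, RCLike.norm_conj]
      ring
  -- The constant monomial drops out by triangularity; negativity of the diagonal is assumed only
  -- from index 1 on.
  have hA0 : ∀ k, 1 ≤ k → A k 0 = 0 := by
    intro k hk
    by_contra h
    exact absurd (htri k 0 h (by omega)) (by omega)
  have hinner : ∀ k ∈ Finset.Ico 1 N,
      ε k * ((starRingEnd ℂ) (e k) * ∑ j ∈ Finset.range M, A k j * e j).re ≤
        -w k + ∑ j ∈ Finset.Ico 1 M, c k j * (w k + w j) := by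
    intro k hk
    obtain ⟨hk1, hkN⟩ := Finset.mem_Ico.1 hk
    have hkM : k ∈ Finset.Ico 1 M := Finset.mem_Ico.2 ⟨hk1, by omega⟩
    have hdiag : ε k * ((starRingEnd ℂ) (e k) * (A k k * e k)).re = -w k := by
      have : (starRingEnd ℂ) (e k) * (A k k * e k) = A k k * ((‖e k‖ ^ 2 : ℝ) : ℂ) := by
        rw [mul_left_comm, Complex.conj_mul']
        push_cast
        rfl
      rw [this, Complex.re_mul_ofReal, hw]
      simp only
      rw [abs_of_neg (hneg k hk1)]
      ring
    rw [Finset.range_eq_Ico, Finset.sum_eq_sum_Ico_succ_bot (by omega), hA0 k hk1, zero_mul,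
      zero_add, Finset.mul_sum, Complex.re_sum, Finset.mul_sum,
      ← Finset.add_sum_erase _ _ hkM, hdiag]
    gcongr
    refine (Finset.sum_le_sum fun j hj => hterm k j hk1 (Finset.ne_of_mem_erase hj).symm).trans ?_
    refine Finset.sum_le_sum_of_subset_of_nonneg (Finset.erase_subset _ _) fun j _ _ => ?_
    have : 0 ≤ c k j := by simp only [hc]; split_ifs <;> positivity
    exact mul_nonneg this (add_nonneg (hw0 k) (hw0 j))
  refine (Finset.sum_le_sum hinner).trans ?_
  have hsplit : ∑ k ∈ Finset.Ico 1 N, ∑ j ∈ Finset.Ico 1 M, c k j * (w k + w j) =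
      ∑ k ∈ Finset.Ico 1 N, (∑ j ∈ Finset.Ico 1 M, c k j) * w k +
        ∑ j ∈ Finset.Ico 1 M, (∑ k ∈ Finset.Ico 1 N, c k j) * w j := by
    simp_rw [mul_add, Finset.sum_add_distrib, Finset.sum_mul]
    congr 1
    exact Finset.sum_comm
  have h1 : ∑ k ∈ Finset.Ico 1 N, (∑ j ∈ Finset.Ico 1 M, c k j) * w k ≤
      √q / 2 * ∑ k ∈ Finset.Ico 1 N, w k := by
    rw [Finset.mul_sum]
    exact Finset.sum_le_sum fun k _ => mul_le_mul_of_nonneg_right (hcrow _ _) (hw0 k)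
  have h2 : ∑ j ∈ Finset.Ico 1 M, (∑ k ∈ Finset.Ico 1 N, c k j) * w j ≤
      √q / 2 * ∑ k ∈ Finset.Ico 1 M, w k := by
    rw [Finset.mul_sum]
    exact Finset.sum_le_sum fun k _ => mul_le_mul_of_nonneg_right (hccol _ _) (hw0 k)
  rw [← Finset.sum_Ico_consecutive w hN hNM] at h2
  rw [Finset.sum_add_distrib, Finset.sum_neg_distrib, hsplit]
  linarith

/-- From J on the ratios are at most q, so any nondecreasing weights suffice. Below J there are
finitely many ratios, and a factor M ≥ ρ/q per index compensates them. Stopping the growth at J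
keeps the weights bounded. -/
theorem exists_bounded_weights {ι : Type*} [Finite ι] (ρ : ι → ℕ → ℕ → ℝ) {q : ℝ} (hq : 0 < q)
    (J : ℕ) (hJ : ∀ i j k, J ≤ j → 1 ≤ k → k < j → ρ i j k ≤ q) :
    ∃ (ε : ℕ → ℝ) (E : ℝ), (∀ k, 1 ≤ ε k) ∧ (∀ k, ε k ≤ E) ∧
      ∀ i j k, 1 ≤ k → k < j → ε k * ρ i j k ≤ q * ε j := by
  obtain ⟨B, hB⟩ := (Set.toFinite ((fun p : ι × Fin J × Fin J =>
    ρ p.1 p.2.1 p.2.2 / q) '' Set.univ)).bddAbove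
  -- The maximum with 1 makes the powers of M nondecreasing and at least 1.
  set M := max 1 B
  have hM1 : 1 ≤ M := le_max_left _ _
  have hM0 : 0 < M := by linarith
  refine ⟨fun k => M ^ min k J, M ^ J, fun k => one_le_pow₀ hM1,
    fun k => pow_le_pow_right₀ hM1 (min_le_right _ _), fun i j k hk hkj => ?_⟩
  have hmono : min k J ≤ min j J := min_le_min hkj.le le_rfl
  rcases le_or_gt J j with hj | hj
  · calc M ^ min k J * ρ i j k ≤ M ^ min k J * q := by
          gcongr
          exact hJ i j k hj hk hkj
      _ = q * M ^ min k J := mul_comm _ _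
      _ ≤ q * M ^ min j J := by gcongr
  · have hρ : ρ i j k ≤ q * M := by
      have : ρ i j k / q ≤ M :=
        (hB ⟨(i, ⟨j, hj⟩, ⟨k, hkj.trans hj⟩), trivial, rfl⟩).trans (le_max_right _ _)
      rwa [div_le_iff₀' hq] at this
    calc M ^ min k J * ρ i j k ≤ M ^ min k J * (q * M) := by gcongr
      _ = q * M ^ (min k J + 1) := by ring
      _ ≤ q * M ^ min j J := by
        gcongr
        omega

end WeightedSums

/-! ### Summability over the multi-indices. -/

section MonomialSums

variable {n : ℕ} [NeZero n]

/-- Finitely many multi-indices lie in a box, over which the sum is a product of n partial geometric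
sums. -/
theorem sum_pow_degree_multiIndex_le {s : ℝ} (h0 : 0 ≤ s) (h1 : s < 1) (S : Finset ℕ) :
    ∑ k ∈ S, s ^ (multiIndex n k).degree ≤ ((1 - s)⁻¹) ^ n := by
  classical
  set D := S.sup fun k => (multiIndex n k).degree
  let g : ℕ ↪ (Fin n → ℕ) :=
    ⟨fun k l => multiIndex n k l, fun a b h => (multiIndex n).injective (DFunLike.coe_injective h)⟩
  have hsub : S.map g ⊆ Fintype.piFinset fun _ : Fin n => Finset.range (D + 1) := by
    intro v hv
    obtain ⟨k, hk, rfl⟩ := Finset.mem_map.1 hv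
    rw [Fintype.mem_piFinset]
    intro l
    have h1 : (multiIndex n k).degree ≤ D := Finset.le_sup (f := fun k => (multiIndex n k).degree) hk
    have h2 := Finsupp.le_degree l (multiIndex n k)
    exact Finset.mem_range.2 (Nat.lt_succ_of_le (h2.trans h1))
  calc ∑ k ∈ S, s ^ (multiIndex n k).degree
      = ∑ v ∈ S.map g, ∏ l, s ^ v l := by
        rw [Finset.sum_map]
        refine Finset.sum_congr rfl fun k _ => ?_
        rw [Finset.prod_pow_eq_pow_sum, Finsupp.degree_eq_sum]
        rfl
    _ ≤ ∑ v ∈ Fintype.piFinset fun _ : Fin n => Finset.range (D + 1), ∏ l, s ^ v l :=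
        Finset.sum_le_sum_of_subset_of_nonneg hsub fun v _ _ =>
          Finset.prod_nonneg fun l _ => pow_nonneg h0 _
    _ = (∑ a ∈ Finset.range (D + 1), s ^ a) ^ n := by
        rw [Finset.sum_prod_piFinset (Finset.range (D + 1)) fun _ a => s ^ a]
        simp
    _ ≤ _ := by
        gcongr
        rw [← tsum_geometric_of_lt_one h0 h1]
        exact (summable_geometric_of_lt_one h0 h1).sum_le_tsum _ fun _ _ => pow_nonneg h0 _

theorem sum_Ico_pow_degree_multiIndex_le {s : ℝ} (h0 : 0 ≤ s) (h1 : s < 1) {N : ℕ} :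
    ∑ k ∈ Finset.Ico 1 N, s ^ (multiIndex n k).degree ≤ ((1 - s)⁻¹) ^ n - 1 := by
  have h := sum_pow_degree_multiIndex_le (n := n) h0 h1 (insert 0 (Finset.Ico 1 N))
  rw [Finset.sum_insert (by simp), multiIndex_zero] at h
  rw [map_zero, pow_zero] at h
  linarith

/-- Write s^d = √s^d · √s^d: one factor absorbs d, the other is summable. -/
theorem summable_degree_mul_pow {s : ℝ} (h0 : 0 ≤ s) (h1 : s < 1) :
    Summable fun k => ((multiIndex n k).degree : ℝ) * s ^ (multiIndex n k).degree := by
  have hs0 : 0 ≤ √s := Real.sqrt_nonneg s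
  have hs1 : √s < 1 := by rw [Real.sqrt_lt' one_pos]; simpa using h1
  have hsum : Summable fun k => √s ^ (multiIndex n k).degree :=
    summable_of_sum_le (fun _ => pow_nonneg hs0 _) fun S => sum_pow_degree_multiIndex_le hs0 hs1 S
  have hb := (summable_pow_mul_geometric_of_norm_lt_one 1
    (r := √s) (by rwa [Real.norm_of_nonneg hs0])).tendsto_atTop_zero.bddAbove_range
  obtain ⟨B, hB⟩ := hb
  refine Summable.of_nonneg_of_le (fun k => by positivity) (fun k => ?_) (hsum.mul_left B)
  have hd := hB ⟨(multiIndex n k).degree, rfl⟩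
  simp only [pow_one] at hd
  calc ((multiIndex n k).degree : ℝ) * s ^ (multiIndex n k).degree
      = ((multiIndex n k).degree * √s ^ (multiIndex n k).degree) *
          √s ^ (multiIndex n k).degree := by
        rw [mul_assoc, ← mul_pow, Real.mul_self_sqrt h0]
    _ ≤ _ := by gcongr

theorem norm_monomialFun_le {s : ℝ} (z : Fin n → ℂ) (hz : ∀ l, ‖z l‖ ≤ s) (k : ℕ) :
    ‖monomialFun k z‖ ≤ s ^ (multiIndex n k).degree := by
  rw [monomialFun, norm_prod, Finsupp.degree_eq_sum, ← Finset.prod_pow_eq_pow_sum]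
  simp_rw [norm_pow]
  exact Finset.prod_le_prod (fun _ _ => by positivity) fun l _ =>
    pow_le_pow_left₀ (norm_nonneg _) (hz l) _

theorem norm_monomialFun_sq_le {s : ℝ} (z : Fin n → ℂ) (hz : ∀ l, ‖z l‖ ≤ s) (k : ℕ) :
    ‖monomialFun k z‖ ^ 2 ≤ (s ^ 2) ^ (multiIndex n k).degree := by
  rw [← pow_mul, mul_comm, pow_mul]
  exact pow_le_pow_left₀ (norm_nonneg _) (norm_monomialFun_le z hz k) 2

end MonomialSums

/-! ### The truncated Lyapunov function and its decay rate. -/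

section Lyapunov

variable {n : ℕ} [NeZero n]

/-- The truncation `∑_{1 ≤ k < N} ε_k |e_k|²` of the Lyapunov function. -/
def lyapunovSum (ε : ℕ → ℝ) (N : ℕ) (z : Fin n → ℂ) : ℝ :=
  ∑ k ∈ Finset.Ico 1 N, ε k * ‖monomialFun k z‖ ^ 2

/-- The derivative of `lyapunovSum ε N` along the vector field `G`. -/
def lyapunovRate (ε : ℕ → ℝ) (N : ℕ) (G : (Fin n → ℂ) → (Fin n → ℂ)) (z : Fin n → ℂ) : ℝ :=
  2 * ∑ k ∈ Finset.Ico 1 N,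
    ε k * ((starRingEnd ℂ) (monomialFun k z) * koopmanGenerator G (monomialFun k) z).re

theorem continuous_lyapunovSum (ε : ℕ → ℝ) (N : ℕ) : Continuous (lyapunovSum (n := n) ε N) := by
  unfold lyapunovSum monomialFun
  fun_prop

theorem hasDerivWithinAt_lyapunovSum (ε : ℕ → ℝ) (N : ℕ) {G : (Fin n → ℂ) → (Fin n → ℂ)}
    {z : ℝ → Fin n → ℂ} {S : Set ℝ} {t : ℝ} (hz : HasDerivWithinAt z (G (z t)) S t) :
    HasDerivWithinAt (fun t => lyapunovSum ε N (z t)) (lyapunovRate ε N G (z t)) S t := by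
  unfold lyapunovSum lyapunovRate
  rw [Finset.mul_sum]
  refine HasDerivWithinAt.fun_sum fun k _ => ?_
  have hk : HasDerivWithinAt (fun t => monomialFun k (z t))
      (koopmanGenerator G (monomialFun k) (z t)) S t := by
    have h := hasFDerivAt_monomialFun k (z t)
    rw [koopmanGenerator]
    rw [← h.fderiv] at h
    exact (h.restrictScalars ℝ).comp_hasDerivWithinAt t hz
  have := hk.norm_sq.const_mul (ε k)
  rw [mul_left_comm]
  simpa [Complex.inner, mul_comm (koopmanGenerator G (monomialFun k) (z t)).re,
    mul_comm (koopmanGenerator G (monomialFun k) (z t)).im] using this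

theorem koopmanGenerator_monomialFun_eq_sum_range (F : Fin n → MvPolynomial (Fin n) ℂ) (N : ℕ) :
    ∃ M, N ≤ M ∧ ∀ k < N, ∀ z, koopmanGenerator (polyField F) (monomialFun k) z =
      ∑ j ∈ Finset.range M, koopmanEntry (polyField F) k j * monomialFun j z := by
  choose M₀ hM₀ using koopmanGenerator_monomialFun_eq_sum F
  refine ⟨max N ((Finset.range N).sup M₀), le_max_left _ _, fun k hk => hM₀ k _ ?_⟩
  exact (Finset.le_sup (Finset.mem_range.2 hk)).trans (le_max_right _ _)

/-- A vector field with upper triangular linear part whose diagonal has real part at most `-c`. -/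
structure IsTriangularStable (c : ℝ) (F : Fin n → MvPolynomial (Fin n) ℂ) : Prop where
  zero : polyField F 0 = 0
  upper : ∀ l q, q < l → jacobianZero F l q = 0
  diag : ∀ l, (jacobianZero F l l).re ≤ -c

/-- The entry is ∑ α_l(k) μ_l with Re μ_l ≤ −c and |α(k)| ≥ 1. -/
theorem IsTriangularStable.re_koopmanEntry_self_le {c : ℝ} {F : Fin n → MvPolynomial (Fin n) ℂ}
    (hF : IsTriangularStable c F) (hc : 0 ≤ c) {k : ℕ} (hk : 1 ≤ k) :
    (koopmanEntry (polyField F) k k).re ≤ -c := by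
  have hd : (1 : ℝ) ≤ ((multiIndex n k).degree : ℝ) := by exact_mod_cast degree_multiIndex_pos hk
  rw [koopmanEntry_self, Complex.re_sum]
  calc ∑ l, ((multiIndex n k l : ℂ) * jacobianZero F l l).re
      ≤ ∑ l, (multiIndex n k l : ℝ) * -c := by
        refine Finset.sum_le_sum fun l _ => ?_
        rw [← Complex.ofReal_natCast, Complex.re_ofReal_mul]
        exact mul_le_mul_of_nonneg_left (hF.diag l) (by positivity)
    _ = (multiIndex n k).degree * -c := by
        rw [← Finset.sum_mul, Finsupp.degree_eq_sum, Nat.cast_sum]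
    _ ≤ -c := by nlinarith

/-- Linear growth in the degree is what makes the truncation error summable. -/
theorem exists_abs_re_koopmanEntry_self_le (F : Fin n → MvPolynomial (Fin n) ℂ) :
    ∃ C, 0 ≤ C ∧ ∀ k, |(koopmanEntry (polyField F) k k).re| ≤ C * (multiIndex n k).degree := by
  refine ⟨∑ l, ‖jacobianZero F l l‖, by positivity, fun k => ?_⟩
  refine (Complex.abs_re_le_norm _).trans ?_
  rw [koopmanEntry_self, Finset.sum_mul]
  refine (norm_sum_le _ _).trans (Finset.sum_le_sum fun l _ => ?_)
  rw [norm_mul, Complex.norm_natCast, mul_comm]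
  gcongr
  exact Finsupp.le_degree l _

/-- The derivative of the truncation involves monomials of index ≥ N. On the closed polydisk of
radius r < 1 their contribution is bounded by a tail of the convergent series ∑ E C d_k r^(2 d_k),
with d_k the degree of e_k, uniformly in z. -/
theorem eventually_lyapunovRate_le {c q E r η : ℝ} {F : Fin n → MvPolynomial (Fin n) ℂ}
    (hF : IsTriangularStable c F) (hc : 0 < c) (hq0 : 0 ≤ q) (hq1 : q ≤ 1) {ε : ℕ → ℝ}
    (hε : ∀ k, 0 ≤ ε k) (hεE : ∀ k, ε k ≤ E)
    (hcpl : ∀ j k, 1 ≤ k → k < j → ε k * couplingRatio F j k ≤ q * ε j)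
    (hr0 : 0 ≤ r) (hr1 : r < 1) (hη : 0 < η) :
    ∀ᶠ N in atTop, ∀ z : Fin n → ℂ, (∀ l, ‖z l‖ ≤ r) →
      lyapunovRate ε N (polyField F) z ≤ -(2 * (1 - √q) * c) * lyapunovSum ε N z + η := by
  obtain ⟨C, hC0, hC⟩ := exists_abs_re_koopmanEntry_self_le F
  have hE0 : 0 ≤ E := (hε 0).trans (hεE 0)
  have hr2 : r ^ 2 < 1 := by nlinarith
  have hsum := ((summable_degree_mul_pow (n := n) (sq_nonneg r) hr2).mul_left (E * C))
  obtain ⟨S, hS⟩ := summable_iff_vanishing_norm.1 hsum η hη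
  obtain ⟨N₀, hN₀⟩ := S.exists_nat_subset_range
  filter_upwards [eventually_ge_atTop (max 1 N₀)] with N hN z hz
  have hN1 : 1 ≤ N := (le_max_left _ _).trans hN
  obtain ⟨M, hNM, hM⟩ := koopmanGenerator_monomialFun_eq_sum_range F N
  have hq1' : √q ≤ 1 := Real.sqrt_le_one.2 hq1
  have key := sum_triangular_coupling_le (A := koopmanEntry (polyField F)) (K := numTerms F)
    (ε := ε) (q := q) (card_row_le_numTerms F) (card_column_le_numTerms F)
    (fun k j h hkj => lt_of_koopmanEntry_ne_zero hF.zero hF.upper h hkj)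
    (fun k hk => (hF.re_koopmanEntry_self_le hc.le hk).trans_lt (by linarith)) hε hq0
    (fun k j hk hkj => hcpl j k hk hkj) (fun k => monomialFun k z) hN1 hNM
  have hlow : c * lyapunovSum ε N z ≤ ∑ k ∈ Finset.Ico 1 N,
      ε k * |(koopmanEntry (polyField F) k k).re| * ‖monomialFun k z‖ ^ 2 := by
    rw [lyapunovSum, Finset.mul_sum]
    refine Finset.sum_le_sum fun k hk => ?_
    have h1 := hF.re_koopmanEntry_self_le hc.le (Finset.mem_Ico.1 hk).1
    have h2 : c ≤ |(koopmanEntry (polyField F) k k).re| := by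
      rw [abs_of_nonpos (by linarith)]
      linarith
    calc c * (ε k * ‖monomialFun k z‖ ^ 2) = ε k * c * ‖monomialFun k z‖ ^ 2 := by ring
      _ ≤ _ := by
        have := hε k
        gcongr
  have htail : ∑ j ∈ Finset.Ico N M,
      ε j * |(koopmanEntry (polyField F) j j).re| * ‖monomialFun j z‖ ^ 2 ≤ η := by
    have hdisj : Disjoint (Finset.Ico N M) S := by
      rw [Finset.disjoint_left]
      intro j hj hjS
      have h1 := Finset.mem_range.1 (hN₀ hjS)
      have h2 := (Finset.mem_Ico.1 hj).1
      have h3 := (le_max_right 1 N₀).trans hN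
      omega
    refine le_trans (Finset.sum_le_sum fun j _ => ?_) ((le_abs_self _).trans (hS _ hdisj).le)
    calc ε j * |(koopmanEntry (polyField F) j j).re| * ‖monomialFun j z‖ ^ 2
        ≤ E * (C * (multiIndex n j).degree) * (r ^ 2) ^ (multiIndex n j).degree := by
          gcongr
          · exact hεE j
          · exact hC j
          · exact norm_monomialFun_sq_le z hz j
      _ = _ := by ring
  have heq : lyapunovRate ε N (polyField F) z = 2 * ∑ k ∈ Finset.Ico 1 N,
      ε k * ((starRingEnd ℂ) (monomialFun k z) *
        ∑ j ∈ Finset.range M, koopmanEntry (polyField F) k j * monomialFun j z).re := by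
    rw [lyapunovRate]
    congr 1
    refine Finset.sum_congr rfl fun k hk => ?_
    rw [hM k (Finset.mem_Ico.1 hk).2]
  rw [heq]
  have h1 := mul_le_mul_of_nonneg_left hlow (sub_nonneg.2 hq1')
  have h2 := mul_le_mul_of_nonneg_left htail (Real.sqrt_nonneg q)
  have h3 : √q * η ≤ η := by nlinarith
  linarith

theorem lyapunovSum_le {E s : ℝ} {ε : ℕ → ℝ} (hε : ∀ k, 0 ≤ ε k) (hεE : ∀ k, ε k ≤ E)
    (h0 : 0 ≤ s) (h1 : s < 1) {z : Fin n → ℂ} (hz : ∀ l, ‖z l‖ ≤ s) (N : ℕ) :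
    lyapunovSum ε N z ≤ E * (((1 - s ^ 2)⁻¹) ^ n - 1) := by
  have hE0 : 0 ≤ E := (hε 0).trans (hεE 0)
  refine le_trans ?_ (mul_le_mul_of_nonneg_left
    (sum_Ico_pow_degree_multiIndex_le (N := N) (sq_nonneg s) (by nlinarith)) hE0)
  rw [lyapunovSum, Finset.mul_sum]
  gcongr with k
  · exact hεE k
  · exact norm_monomialFun_sq_le z hz k

/-- Each coordinate is itself one of the monomials e_k with k ≥ 1, and its weight is at least 1. -/
theorem eventually_norm_sq_le_lyapunovSum {ε : ℕ → ℝ} (hε : ∀ k, 1 ≤ ε k) (z : Fin n → ℂ)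
    (l : Fin n) : ∀ᶠ N in atTop, ‖z l‖ ^ 2 ≤ lyapunovSum ε N z := by
  obtain ⟨k, hk⟩ := (multiIndex n).surjective (Finsupp.single l 1)
  have hk1 : 1 ≤ k := by
    rw [Nat.one_le_iff_ne_zero]
    rintro rfl
    rw [multiIndex_zero] at hk
    exact one_ne_zero (Finsupp.single_eq_zero.1 hk.symm)
  filter_upwards [eventually_gt_atTop k] with N hN
  have hz : monomialFun k z = z l := by
    simp [monomialFun, hk, Finsupp.single_apply]
  calc ‖z l‖ ^ 2 ≤ ε k * ‖monomialFun k z‖ ^ 2 := by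
        rw [hz]
        exact le_mul_of_one_le_left (by positivity) (hε k)
    _ ≤ _ := Finset.single_le_sum (f := fun k => ε k * ‖monomialFun k z‖ ^ 2)
        (fun i _ => mul_nonneg (zero_le_one.trans (hε i)) (by positivity))
        (Finset.mem_Ico.2 ⟨hk1, hN⟩)

end Lyapunov

/-! ### Structure of commutation laws. -/

section SwitchingSignals

variable {ι : Type*} {σ : ℝ → ι}

theorem eq_of_forall_isConstantNear {a b : ℝ} (h : ∀ t ∈ Set.Ioo a b, IsConstantNear σ t) {s t : ℝ}
    (hs : s ∈ Set.Ioo a b) (ht : t ∈ Set.Ioo a b) : σ s = σ t := by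
  -- For the discrete topology, constancy near each point is continuity, and the interval is
  -- preconnected.
  let _ : TopologicalSpace ι := ⊥
  have : DiscreteTopology ι := ⟨rfl⟩
  refine isPreconnected_Ioo.constant (fun u hu => ContinuousAt.continuousWithinAt ?_) hs ht
  exact tendsto_const_nhds.congr' ((h u hu).mono fun v hv => hv.symm)

theorem IsCommutationLaw.exists_eventually_right_eq (hσ : IsCommutationLaw σ) {t : ℝ}
    (ht : 0 ≤ t) : ∃ i, ∀ᶠ s in 𝓝[>] t, σ s = i := by
  have hfin := (hσ (t + 1)).subset (Set.sdiff_subset (t := {t}))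
  have h1 : ∀ᶠ s in 𝓝[>] t, s ∉ {s : ℝ | 0 < s ∧ s ≤ t + 1 ∧ ¬ IsConstantNear σ s} \ {t} :=
    nhdsWithin_le_nhds (hfin.isClosed.isOpen_compl.mem_nhds (by simp))
  have h2 : ∀ᶠ s in 𝓝[>] t, s ∈ Set.Ioo t (t + 1) := Ioo_mem_nhdsGT (by linarith)
  obtain ⟨u, htu, hu⟩ := mem_nhdsGT_iff_exists_Ioo_subset.1 (h1.and h2)
  have hconst : ∀ s ∈ Set.Ioo t u, IsConstantNear σ s := by
    intro s hs
    obtain ⟨h3, h4⟩ := hu hs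
    by_contra hc
    exact h3 ⟨⟨ht.trans_lt h4.1, h4.2.le, hc⟩, h4.1.ne'⟩
  obtain ⟨v, hv⟩ := Set.nonempty_Ioo.2 (Set.mem_Ioi.1 htu)
  exact ⟨σ v, mem_of_superset (Ioo_mem_nhdsGT htu)
    fun s hs => eq_of_forall_isConstantNear hconst hs hv⟩

/-- To prove a property of all time intervals that is stable under concatenation it suffices to
consider the intervals on which the commutation law is constant. -/
theorem IsCommutationLaw.induction_on_intervals (hσ : IsCommutationLaw σ) {Q : ℝ → ℝ → Prop}
    (trans : ∀ a b c, 0 ≤ a → a < b → b < c → Q a b → Q b c → Q a c)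
    (const : ∀ a b i, 0 ≤ a → a < b → (∀ t ∈ Set.Ioo a b, σ t = i) → Q a b)
    {a b : ℝ} (ha : 0 ≤ a) (hab : a < b) : Q a b := by
  have hfin : ∀ a b, 0 ≤ a → {t | t ∈ Set.Ioo a b ∧ ¬ IsConstantNear σ t}.Finite :=
    fun a b ha => (hσ b).subset fun t ht => ⟨ha.trans_lt ht.1.1, ht.1.2.le, ht.2⟩
  induction h : {t | t ∈ Set.Ioo a b ∧ ¬ IsConstantNear σ t}.ncard using Nat.strong_induction_on
    generalizing a b with
  | _ N ih =>
    subst h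
    by_cases hc : ∀ t ∈ Set.Ioo a b, IsConstantNear σ t
    · obtain ⟨v, hv⟩ := Set.nonempty_Ioo.2 hab
      exact const a b (σ v) ha hab fun t ht => eq_of_forall_isConstantNear hc ht hv
    · push Not at hc
      obtain ⟨s, hs, hsc⟩ := hc
      -- Cutting at a switching time s leaves strictly fewer interior switching times on each side.
      refine trans a s b ha hs.1 hs.2 (ih _ ?_ ha hs.1 rfl) (ih _ ?_ (ha.trans hs.1.le) hs.2 rfl)
      · refine Set.ncard_lt_ncard ⟨fun t ht => ⟨⟨ht.1.1, ht.1.2.trans hs.2⟩, ht.2⟩, fun hsub => ?_⟩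
          (hfin a b ha)
        exact lt_irrefl s (hsub ⟨hs, hsc⟩).1.2
      · refine Set.ncard_lt_ncard ⟨fun t ht => ⟨⟨hs.1.trans ht.1.1, ht.1.2⟩, ht.2⟩, fun hsub => ?_⟩
          (hfin a b ha)
        exact lt_irrefl s (hsub ⟨hs, hsc⟩).1.1

end SwitchingSignals

/-! ### Uniqueness, invariance and existence of switched trajectories. -/

section Trajectories

variable {E : Type*} [NormedAddCommGroup E] [NormedSpace ℝ E] {ι : Type*}
  {F : ι → E → E} {σ : ℝ → ι} {a b c : ℝ} {x y : ℝ → E}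

/-- `x` is a trajectory of the switched system on `[a, b]`: it is continuous, and solves the
equation of the active subsystem at all but finitely many times. -/
def IsTrajectoryOn (F : ι → E → E) (σ : ℝ → ι) (a b : ℝ) (x : ℝ → E) : Prop :=
  ContinuousOn x (Set.Icc a b) ∧
    ∃ S : Set ℝ, S.Finite ∧ ∀ t ∈ Set.Ioo a b, t ∉ S → HasDerivAt x (F (σ t) (x t)) t

theorem IsTrajectory.isTrajectoryOn (hσ : IsCommutationLaw σ) (hx : IsTrajectory F σ x)
    (ha : 0 ≤ a) : IsTrajectoryOn F σ a b x := by
  refine ⟨hx.1.mono fun t ht => ha.trans ht.1, _, hσ b, fun t ht hS => ?_⟩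
  have ht0 := ha.trans_lt ht.1
  refine hx.2 t ht0 ?_
  by_contra hc
  exact hS ⟨ht0, ht.2.le, hc⟩

theorem IsTrajectoryOn.mono (hx : IsTrajectoryOn F σ a c x) {a' c' : ℝ} (ha : a ≤ a')
    (hc : c' ≤ c) : IsTrajectoryOn F σ a' c' x := by
  obtain ⟨h, S, hS, hd⟩ := hx
  exact ⟨h.mono (Set.Icc_subset_Icc ha hc), S, hS, fun t ht => hd t (Set.Ioo_subset_Ioo ha hc ht)⟩

/-- The junction b joins the exceptional set; this is why that set may be any finite set and not
only the switching times. -/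
theorem IsTrajectoryOn.concat (hab : a ≤ b) (hbc : b ≤ c) (hx : IsTrajectoryOn F σ a b x)
    (hy : IsTrajectoryOn F σ b c y) (h : x b = y b) :
    IsTrajectoryOn F σ a c fun t => if t ≤ b then x t else y t := by
  obtain ⟨hx1, S, hS, hx2⟩ := hx
  obtain ⟨hy1, S', hS', hy2⟩ := hy
  constructor
  · rw [← Set.Icc_union_Icc_eq_Icc hab hbc]
    refine ContinuousOn.union_of_isClosed (hx1.congr fun t ht => if_pos ht.2)
      (hy1.congr fun t ht => ?_) isClosed_Icc isClosed_Icc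
    rcases ht.1.eq_or_lt with rfl | hlt
    · simpa using h
    · exact if_neg (not_le.2 hlt)
  · refine ⟨S ∪ S' ∪ {b}, (hS.union hS').union (Set.finite_singleton b), fun t ht htS => ?_⟩
    simp only [Set.mem_union, Set.mem_singleton_iff, not_or] at htS
    rcases lt_or_gt_of_ne htS.2 with hlt | hlt
    · beta_reduce
      rw [if_pos hlt.le]
      refine (hx2 t ⟨ht.1, hlt⟩ htS.1.1).congr_of_eventuallyEq ?_
      filter_upwards [Iio_mem_nhds hlt] with s hs
      exact if_pos (le_of_lt hs)
    · beta_reduce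
      rw [if_neg (not_le.2 hlt)]
      refine (hy2 t ⟨hlt, ht.2⟩ htS.1.2).congr_of_eventuallyEq ?_
      filter_upwards [Ioi_mem_nhds hlt] with s hs
      exact if_neg (not_le.2 hs)

theorem IsSolution.isTrajectoryOn {i : ι} (hy : IsSolution (F i) y)
    (hσ : ∀ t ∈ Set.Ioo a b, σ t = i) : IsTrajectoryOn F σ a b fun t => y (t - a) := by
  refine ⟨?_, ∅, Set.finite_empty, fun t ht _ => ?_⟩
  · have hc : ContinuousOn y (Set.Ici 0) := fun t ht => (hy t ht).continuousWithinAt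
    exact hc.comp (by fun_prop) fun t ht => sub_nonneg.2 ht.1
  · rw [hσ t ht]
    have h0 : 0 < t - a := sub_pos.2 ht.1
    exact ((hy (t - a) h0.le).hasDerivAt (Ici_mem_nhds h0)).comp_sub_const t a

/-- Even at an exceptional time the derivative has a limit from the right, by continuity of x and F
i, and this limit is then the right derivative. -/
theorem IsTrajectoryOn.hasDerivWithinAt_Ici (hx : IsTrajectoryOn F σ a b x) {i : ι}
    (hF : Continuous (F i)) {t : ℝ} (hat : a ≤ t) (htb : t < b) (hσ : ∀ᶠ s in 𝓝[>] t, σ s = i) :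
    HasDerivWithinAt x (F i (x t)) (Set.Ici t) t := by
  obtain ⟨hc, S, hS, hd⟩ := hx
  have h1 : ∀ᶠ s in 𝓝[>] t, s ∉ S := by
    have : ∀ᶠ s in 𝓝[>] t, s ∉ S \ {t} :=
      nhdsWithin_le_nhds ((hS.subset Set.sdiff_subset).isClosed.isOpen_compl.mem_nhds (by simp))
    filter_upwards [this, self_mem_nhdsWithin] with s hs hts hsS
    exact hs ⟨hsS, (Set.mem_Ioi.1 hts).ne'⟩
  have h2 : ∀ᶠ s in 𝓝[>] t, s ∈ Set.Ioo t b := Ioo_mem_nhdsGT htb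
  have hd' : ∀ s, (s ∉ S ∧ s ∈ Set.Ioo t b) ∧ σ s = i → HasDerivAt x (F i (x s)) s := by
    rintro s ⟨⟨h3, h4⟩, rfl⟩
    exact hd s ⟨hat.trans_lt h4.1, h4.2⟩ h3
  have hct : ContinuousWithinAt x (Set.Ioo t b) t :=
    (hc t ⟨hat, htb.le⟩).mono fun s hs => ⟨hat.trans hs.1.le, hs.2.le⟩
  refine hasDerivWithinAt_Ici_of_tendsto_deriv
    (fun s hs => (hd' s hs).differentiableAt.differentiableWithinAt)
    (hct.mono fun s hs => hs.1.2) ((h1.and h2).and hσ) ?_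
  have hlim : Tendsto (fun s => F i (x s)) (𝓝[>] t) (𝓝 (F i (x t))) := by
    rw [← nhdsWithin_Ioo_eq_nhdsGT htb]
    exact (hF.tendsto _).comp hct
  refine hlim.congr' ?_
  filter_upwards [(h1.and h2).and hσ] with s hs
  exact (hd' s hs).deriv.symm

theorem IsTrajectoryOn.hasDerivWithinAt_Iic (hx : IsTrajectoryOn F σ a b x) {i : ι}
    (hF : Continuous (F i)) {t : ℝ} (hat : a < t) (htb : t ≤ b) (hσ : ∀ᶠ s in 𝓝[<] t, σ s = i) :
    HasDerivWithinAt x (F i (x t)) (Set.Iic t) t := by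
  obtain ⟨hc, S, hS, hd⟩ := hx
  have h1 : ∀ᶠ s in 𝓝[<] t, s ∉ S := by
    have : ∀ᶠ s in 𝓝[<] t, s ∉ S \ {t} :=
      nhdsWithin_le_nhds ((hS.subset Set.sdiff_subset).isClosed.isOpen_compl.mem_nhds (by simp))
    filter_upwards [this, self_mem_nhdsWithin] with s hs hts hsS
    exact hs ⟨hsS, (Set.mem_Iio.1 hts).ne⟩
  have h2 : ∀ᶠ s in 𝓝[<] t, s ∈ Set.Ioo a t := Ioo_mem_nhdsLT hat
  have hd' : ∀ s, (s ∉ S ∧ s ∈ Set.Ioo a t) ∧ σ s = i → HasDerivAt x (F i (x s)) s := by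
    rintro s ⟨⟨h3, h4⟩, rfl⟩
    exact hd s ⟨h4.1, h4.2.trans_le htb⟩ h3
  have hct : ContinuousWithinAt x (Set.Ioo a t) t :=
    (hc t ⟨hat.le, htb⟩).mono fun s hs => ⟨hs.1.le, hs.2.le.trans htb⟩
  refine hasDerivWithinAt_Iic_of_tendsto_deriv
    (fun s hs => (hd' s hs).differentiableAt.differentiableWithinAt)
    (hct.mono fun s hs => hs.1.2) ((h1.and h2).and hσ) ?_
  have hlim : Tendsto (fun s => F i (x s)) (𝓝[<] t) (𝓝 (F i (x t))) := by
    rw [← nhdsWithin_Ioo_eq_nhdsLT hat]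
    exact (hF.tendsto _).comp hct
  refine hlim.congr' ?_
  filter_upwards [(h1.and h2).and hσ] with s hs
  exact (hd' s hs).deriv.symm

/-- The two one-sided derivatives agree where σ does not switch, so exceptional times that are mere
junctions disappear. -/
theorem IsTrajectoryOn.hasDerivAt (hx : IsTrajectoryOn F σ a b x) {t : ℝ}
    (hF : Continuous (F (σ t))) (ht : t ∈ Set.Ioo a b) (hσ : IsConstantNear σ t) :
    HasDerivAt x (F (σ t) (x t)) t := by
  have h1 := hx.hasDerivWithinAt_Ici hF ht.1.le ht.2 (nhdsWithin_le_nhds hσ)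
  have h2 := hx.hasDerivWithinAt_Iic hF ht.1 ht.2.le (nhdsWithin_le_nhds hσ)
  have := h2.union h1
  rwa [Set.Iic_union_Ici, hasDerivWithinAt_univ] at this

/-- Both curves have compact image, so F i is Lipschitz on the union of the images. -/
theorem IsTrajectoryOn.eqOn_of_const {i : ι} (hF : LocallyLipschitz (F i))
    (hσ : ∀ t ∈ Set.Ioo a b, σ t = i) (hx : IsTrajectoryOn F σ a b x)
    (hy : IsTrajectoryOn F σ a b y) (h : x a = y a) : Set.EqOn x y (Set.Icc a b) := by
  have hK := (isCompact_Icc.image_of_continuousOn hx.1).union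
    (isCompact_Icc.image_of_continuousOn hy.1)
  obtain ⟨K, hLip⟩ := (hF.locallyLipschitzOn (s := _)).exists_lipschitzOnWith_of_compact hK
  have hσ' : ∀ t ∈ Set.Ico a b, ∀ᶠ s in 𝓝[>] t, σ s = i := fun t ht =>
    mem_of_superset (Ioo_mem_nhdsGT ht.2) fun s hs => hσ s ⟨ht.1.trans_lt hs.1, hs.2⟩
  exact ODE_solution_unique_of_mem_Icc_right (v := fun _ => F i)
    (fun t _ => hLip) hx.1
    (fun t ht => hx.hasDerivWithinAt_Ici hF.continuous ht.1 ht.2 (hσ' t ht))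
    (fun t ht => Or.inl ⟨t, Set.Ico_subset_Icc_self ht, rfl⟩) hy.1
    (fun t ht => hy.hasDerivWithinAt_Ici hF.continuous ht.1 ht.2 (hσ' t ht))
    (fun t ht => Or.inr ⟨t, Set.Ico_subset_Icc_self ht, rfl⟩) h

theorem IsTrajectoryOn.eqOn (hF : ∀ i, LocallyLipschitz (F i)) (hσ : IsCommutationLaw σ)
    (ha : 0 ≤ a) (hab : a < b) : ∀ {x y : ℝ → E}, IsTrajectoryOn F σ a b x →
      IsTrajectoryOn F σ a b y → x a = y a → Set.EqOn x y (Set.Icc a b) := by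
  refine hσ.induction_on_intervals (Q := fun a b => ∀ {x y : ℝ → E}, IsTrajectoryOn F σ a b x →
    IsTrajectoryOn F σ a b y → x a = y a → Set.EqOn x y (Set.Icc a b)) ?_ ?_ ha hab
  · intro a b c _ hab hbc h1 h2 x y hx hy h
    have e1 := h1 (hx.mono le_rfl hbc.le) (hy.mono le_rfl hbc.le) h
    have e2 := h2 (hx.mono hab.le le_rfl) (hy.mono hab.le le_rfl) (e1 ⟨hab.le, le_rfl⟩)
    rw [← Set.Icc_union_Icc_eq_Icc hab.le hbc.le]
    exact e1.union e2
  · intro a b i _ _ hi x y hx hy h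
    exact hx.eqOn_of_const (hF i) hi hy h

variable {D : Set E}

/-- Invariance concerns solutions on all of [0, ∞). While σ is constant, the trajectory coincides by
uniqueness with a time shift of such a solution, which completeness provides. -/
theorem IsTrajectoryOn.mem (hF : ∀ i, LocallyLipschitz (F i)) (hσ : IsCommutationLaw σ)
    (hcomp : ∀ i, ∀ x₀ ∈ D, ∃ x : ℝ → E, IsSolution (F i) x ∧ x 0 = x₀)
    (hinv : ∀ i, IsInvariantForward (F i) D)
    (ha : 0 ≤ a) (hab : a < b) : ∀ {x : ℝ → E}, IsTrajectoryOn F σ a b x → x a ∈ D →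
      ∀ t ∈ Set.Icc a b, x t ∈ D := by
  refine hσ.induction_on_intervals (Q := fun a b => ∀ {x : ℝ → E}, IsTrajectoryOn F σ a b x →
    x a ∈ D → ∀ t ∈ Set.Icc a b, x t ∈ D) ?_ ?_ ha hab
  · intro a b c _ hab hbc h1 h2 x hx h t ht
    have e1 := h1 (hx.mono le_rfl hbc.le) h
    rcases le_total t b with htb | htb
    · exact e1 t ⟨ht.1, htb⟩
    · exact h2 (hx.mono hab.le le_rfl) (e1 b ⟨hab.le, le_rfl⟩) t ⟨htb, ht.2⟩
  · intro a b i _ _ hi x hx h t ht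
    obtain ⟨y, hy, hy0⟩ := hcomp i _ h
    rw [hx.eqOn_of_const (hF i) hi (hy.isTrajectoryOn hi) (by simp [hy0]) ht]
    exact hinv i y hy (hy0 ▸ h) _ (sub_nonneg.2 ht.1)

theorem exists_isTrajectoryOn (hF : ∀ i, LocallyLipschitz (F i)) (hσ : IsCommutationLaw σ)
    (hcomp : ∀ i, ∀ x₀ ∈ D, ∃ x : ℝ → E, IsSolution (F i) x ∧ x 0 = x₀)
    (hinv : ∀ i, IsInvariantForward (F i) D)
    (ha : 0 ≤ a) (hab : a < b) : ∀ z ∈ D, ∃ x, IsTrajectoryOn F σ a b x ∧ x a = z := by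
  refine hσ.induction_on_intervals (Q := fun a b => ∀ z ∈ D, ∃ x, IsTrajectoryOn F σ a b x ∧
    x a = z) ?_ ?_ ha hab
  · intro a b c ha hab hbc h1 h2 z hz
    obtain ⟨x, hx, rfl⟩ := h1 z hz
    obtain ⟨y, hy, hxy⟩ := h2 (x b) (hx.mem hF hσ hcomp hinv ha hab hz b ⟨hab.le, le_rfl⟩)
    exact ⟨_, hx.concat hab.le hbc.le hy hxy.symm, if_pos hab.le⟩
  · intro a b i _ _ hi z hz
    obtain ⟨y, hy, rfl⟩ := hcomp i z hz
    exact ⟨_, hy.isTrajectoryOn hi, by simp⟩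

theorem exists_isTrajectory (hF : ∀ i, LocallyLipschitz (F i)) (hσ : IsCommutationLaw σ)
    (hcomp : ∀ i, ∀ x₀ ∈ D, ∃ x : ℝ → E, IsSolution (F i) x ∧ x 0 = x₀)
    (hinv : ∀ i, IsInvariantForward (F i) D) {z : E} (hz : z ∈ D) :
    ∃ x, IsTrajectory F σ x ∧ x 0 = z := by
  have hpos : ∀ N : ℕ, (0 : ℝ) < N + 1 := fun N => by positivity
  choose X hX hX0 using fun N : ℕ =>
    exists_isTrajectoryOn hF hσ hcomp hinv le_rfl (hpos N) z hz
  have heq : ∀ N M : ℕ, ∀ t : ℝ, 0 ≤ t → t ≤ N + 1 → t ≤ M + 1 → X N t = X M t := by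
    intro N M t h0 hN hM
    rcases h0.eq_or_lt with rfl | h0'
    · rw [hX0, hX0]
    · exact ((hX N).mono le_rfl hN).eqOn hF hσ le_rfl h0' ((hX M).mono le_rfl hM)
        (by rw [hX0, hX0]) ⟨h0, le_rfl⟩
  -- The piece of index ⌈t⌉ lives on [0, ⌈t⌉ + 1], leaving room to the right of t for local
  -- arguments.
  have hceil : ∀ t : ℝ, t < ⌈t⌉₊ + 1 := fun t => (Nat.le_ceil t).trans_lt (lt_add_one _)
  refine ⟨fun t => X ⌈t⌉₊ t, ⟨fun t ht => ?_, fun t ht hσt => ?_⟩, hX0 _⟩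
  · have hc := (hX ⌈t⌉₊).1 t ⟨ht, (hceil t).le⟩
    have hn : Set.Icc 0 ((⌈t⌉₊ : ℝ) + 1) ∈ 𝓝[Set.Ici 0] t :=
      mem_of_superset (inter_mem_nhdsWithin (Set.Ici 0) (Iic_mem_nhds (hceil t))) fun s hs => hs
    refine ContinuousWithinAt.congr_of_eventuallyEq (hc.mono_of_mem_nhdsWithin hn) ?_ rfl
    filter_upwards [hn] with s hs
    exact heq _ _ s hs.1 (hceil s).le hs.2
  · refine ((hX ⌈t⌉₊).hasDerivAt (hF _).continuous ⟨ht, hceil t⟩ hσt).congr_of_eventuallyEq ?_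
    filter_upwards [Ioo_mem_nhds ht (hceil t)] with s hs
    exact heq _ _ s hs.1.le (hceil s).le hs.2.le

end Trajectories

/-! ### Simultaneous triangularization by Lie's theorem. -/

section SimultaneousTriangularization

open Module in
/-- A finite-dimensional module over a solvable complex Lie algebra has a basis in which all
elements of the Lie algebra act by upper triangular matrices. -/
theorem LieModule.exists_basis_triangular {L : Type*} [LieRing L] [LieAlgebra ℂ L]
    [LieAlgebra.IsSolvable L] {d : ℕ} {V : Type*} [AddCommGroup V] [Module ℂ V]
    [FiniteDimensional ℂ V] [LieRingModule L V] [LieModule ℂ L V] (hd : finrank ℂ V = d) :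
    ∃ b : Basis (Fin d) ℂ V, ∀ (x : L) (l q : Fin d), q < l → b.repr ⁅x, b q⁆ l = 0 := by
  induction d generalizing V with
  | zero => exact ⟨finBasisOfFinrankEq ℂ V hd, fun x l => l.elim0⟩
  | succ d ih =>
    have : Nontrivial V := nontrivial_of_finrank_pos (R := ℂ) (by omega)
    -- Lie's theorem is applied to the dual: the kernel of a common eigenfunctional is an invariant
    -- hyperplane, so the induction passes to a submodule and needs no quotient.
    obtain ⟨χ, hχ⟩ := LieModule.exists_nontrivial_weightSpace_of_isSolvable ℂ L (V →ₗ[ℂ] ℂ)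
    obtain ⟨⟨φ, hφ⟩, hφ0⟩ := exists_ne (0 : LieModule.weightSpace (V →ₗ[ℂ] ℂ) χ)
    rw [LieModule.mem_weightSpace] at hφ
    have hφ0 : φ ≠ 0 := fun h => hφ0 (Subtype.ext h)
    have hφx : ∀ (x : L) (v : V), φ v = 0 → φ ⁅x, v⁆ = 0 := by
      intro x v hv
      have := LinearMap.congr_fun (hφ x) v
      rwa [Module.Dual.lie_apply, LinearMap.smul_apply, hv, smul_zero, neg_eq_zero] at this
    let N : LieSubmodule ℂ L V := { LinearMap.ker φ with lie_mem := fun {x v} hv => hφx x v hv }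
    have hker : finrank ℂ (LinearMap.ker φ) = d := by
      have h1 := LinearMap.finrank_range_add_finrank_ker φ
      rw [LinearMap.range_eq_top.2 (LinearMap.surjective hφ0), finrank_top, finrank_self] at h1
      omega
    obtain ⟨b, hb⟩ := ih (V := N) hker
    obtain ⟨y, hy⟩ : ∃ y, φ y ≠ 0 := by
      by_contra! hc
      exact hφ0 (LinearMap.ext hc)
    let b' : Basis (Fin d) ℂ (LinearMap.ker φ) := b
    -- The vector outside the hyperplane goes last, since the last column of a triangular matrix is
    -- unconstrained.
    let B : Basis (Fin (d + 1)) ℂ V := Basis.mkFinSnoc b' y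
      (fun c v hv h => by
        have := congrArg φ h
        rw [map_add, map_smul, LinearMap.mem_ker.1 hv, add_zero, map_zero, smul_eq_mul] at this
        exact (mul_eq_zero.1 this).resolve_right hy)
      (fun z => ⟨-(φ z / φ y), by simp [hy]⟩)
    have hBcast : ∀ q : Fin d, B q.castSucc = (b q : V) := fun q => by
      simp only [B, Basis.coe_mkFinSnoc, Fin.snoc_castSucc]
      rfl
    have hrepr : ∀ (v : N), B.repr (v : V) = ∑ q, b.repr v q • Finsupp.single q.castSucc (1 : ℂ) := by
      intro v
      have hv : (v : V) = ∑ q, b.repr v q • (b q : V) :=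
        (congrArg N.incl (b.sum_repr v)).symm.trans (map_sum N.incl _ _)
      rw [hv, map_sum]
      refine Finset.sum_congr rfl fun q _ => ?_
      rw [map_smul, ← hBcast, Basis.repr_self]
    refine ⟨B, fun x l q hql => ?_⟩
    induction q using Fin.lastCases with
    | last => exact absurd hql (not_lt.2 (Fin.le_last l))
    | cast q =>
      rw [hBcast, ← LieSubmodule.coe_bracket, hrepr, Finsupp.finsetSum_apply]
      refine Finset.sum_eq_zero fun r _ => ?_
      rw [Finsupp.smul_apply, Finsupp.single_apply]
      split_ifs with hr
      · rw [hb x r q (by rwa [← hr, Fin.castSucc_lt_castSucc_iff] at hql), zero_smul]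
      · exact smul_zero _

attribute [local instance] LieRing.ofAssociativeRing

open Module in
theorem GeneratesSolvable.exists_triangular {n : ℕ} {ι : Type*} {A : ι → Matrix (Fin n) (Fin n) ℂ}
    (hA : GeneratesSolvable A) : ∃ P : Matrix (Fin n) (Fin n) ℂ, IsUnit P.det ∧
      ∀ i l q, q < l → (P⁻¹ * A i * P) l q = 0 := by
  have : LieAlgebra.IsSolvable
    (LieSubalgebra.lieSpan ℂ (Matrix (Fin n) (Fin n) ℂ) (Set.range A)) := hA
  obtain ⟨b, hb⟩ := LieModule.exists_basis_triangular
    (L := LieSubalgebra.lieSpan ℂ (Matrix (Fin n) (Fin n) ℂ) (Set.range A))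
    (V := Fin n → ℂ) (d := n) (by simp)
  let e := Pi.basisFun ℂ (Fin n)
  have h1 : b.toMatrix e * e.toMatrix b = 1 := b.toMatrix_mul_toMatrix_flip e
  have hinv : (e.toMatrix b)⁻¹ = b.toMatrix e := Matrix.inv_eq_left_inv h1
  refine ⟨e.toMatrix b, Matrix.isUnit_det_of_left_inverse h1, fun i l q hql => ?_⟩
  have hAi : LinearMap.toMatrix e e (Matrix.toLin' (A i)) = A i := LinearMap.toMatrix'_toLin' _
  have h2 : b.toMatrix e * A i * e.toMatrix b = LinearMap.toMatrix b b (Matrix.toLin' (A i)) := by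
    rw [← basis_toMatrix_mul_linearMap_toMatrix_mul_basis_toMatrix b e b e (Matrix.toLin' (A i)),
      hAi]
  rw [hinv, h2, LinearMap.toMatrix_apply, Matrix.toLin'_apply]
  exact hb ⟨A i, LieSubalgebra.subset_lieSpan ⟨i, rfl⟩⟩ l q hql

end SimultaneousTriangularization

/-! ### Normalizing ‖P⁻¹‖ = 1. -/

section Normalization

attribute [local instance] Matrix.linftyOpNormedAddCommGroup Matrix.linftyOpNormedSpace

theorem matrixSupNorm_smul {n : ℕ} (c : ℂ) (A : Matrix (Fin n) (Fin n) ℂ) :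
    matrixSupNorm (c • A) = ‖c‖ * matrixSupNorm A :=
  norm_smul c A

theorem matrixSupNorm_pos {n : ℕ} {A : Matrix (Fin n) (Fin n) ℂ} (hA : A ≠ 0) :
    0 < matrixSupNorm A :=
  norm_pos_iff.2 hA

theorem norm_mulVec_le {n : ℕ} (A : Matrix (Fin n) (Fin n) ℂ) (v : Fin n → ℂ) :
    ‖A.mulVec v‖ ≤ matrixSupNorm A * ‖v‖ :=
  Matrix.linfty_opNorm_mulVec A v

/-- Conjugation does not see a scalar factor of P, so P may be multiplied by ‖P⁻¹‖, which is nonzero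
because n ≥ 1. -/
theorem exists_isTriangularizer {n : ℕ} [NeZero n] {ι : Type*}
    {A : ι → Matrix (Fin n) (Fin n) ℂ} (hA : GeneratesSolvable A) :
    ∃ P, IsTriangularizer A P := by
  obtain ⟨P, hP, hup⟩ := hA.exists_triangular
  have hP0 : P⁻¹ ≠ 0 := by
    intro h
    have := Matrix.nonsing_inv_mul P hP
    rw [h, zero_mul] at this
    exact zero_ne_one this
  have hs := matrixSupNorm_pos hP0
  set s : ℂ := (matrixSupNorm P⁻¹ : ℂ)
  have hs0 : s ≠ 0 := Complex.ofReal_ne_zero.2 hs.ne'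
  have hinv : (s • P)⁻¹ = s⁻¹ • P⁻¹ := by
    refine Matrix.inv_eq_left_inv ?_
    rw [Matrix.smul_mul, Matrix.mul_smul, smul_smul, inv_mul_cancel₀ hs0, one_smul,
      Matrix.nonsing_inv_mul P hP]
  refine ⟨s • P, ?_, ?_, fun i l q hql => ?_⟩
  · rw [Matrix.det_smul]
    exact (IsUnit.mk0 _ (pow_ne_zero _ hs0)).mul hP
  · rw [hinv, matrixSupNorm_smul, norm_inv, Complex.norm_of_nonneg hs.le, inv_mul_cancel₀ hs.ne']
  · rw [hinv, Matrix.smul_mul, Matrix.smul_mul, Matrix.mul_smul, smul_smul, inv_mul_cancel₀ hs0,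
      one_smul, hup i l q hql]

end Normalization

/-! ### Exponential decay from Grönwall's inequality. -/

section Decay

theorem tendsto_zero_of_norm_sq_le_exp {E : Type*} [NormedAddCommGroup E] {x : ℝ → E} {B κ : ℝ}
    (hκ : 0 < κ) (h : ∀ t, 0 ≤ t → ‖x t‖ ^ 2 ≤ B * Real.exp (-κ * t)) :
    Tendsto x atTop (𝓝 0) := by
  have h1 : Tendsto (fun t => B * Real.exp (-κ * t)) atTop (𝓝 0) := by
    rw [← mul_zero B]
    refine (Real.tendsto_exp_atBot.comp ?_).const_mul B
    exact tendsto_id.const_mul_atTop_of_neg (neg_neg_of_pos hκ)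
  have h2 : Tendsto (fun t => ‖x t‖ ^ 2) atTop (𝓝 0) :=
    squeeze_zero' (Eventually.of_forall fun t => sq_nonneg _)
      ((eventually_ge_atTop 0).mono h) h1
  have h3 := h2.sqrt
  rw [Real.sqrt_zero] at h3
  exact tendsto_zero_iff_norm_tendsto_zero.2 (h3.congr fun t => Real.sqrt_sq (norm_nonneg _))

variable {n : ℕ} [NeZero n] {ι : Type*} [Finite ι] [Nonempty ι]

/-- The truncated V serves all subsystems at once, so its differential inequality holds whichever of
them is active. -/
theorem norm_sq_le_of_isTriangularStable {c q E s T : ℝ} {G : ι → Fin n → MvPolynomial (Fin n) ℂ}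
    (hG : ∀ i, IsTriangularStable c (G i)) (hc : 0 < c) (hq0 : 0 ≤ q) (hq1 : q < 1)
    {ε : ℕ → ℝ} (hε : ∀ k, 1 ≤ ε k) (hεE : ∀ k, ε k ≤ E)
    (hcpl : ∀ i j k, 1 ≤ k → k < j → ε k * couplingRatio (G i) j k ≤ q * ε j)
    {z : ℝ → Fin n → ℂ} (hT : 0 ≤ T) (hz : ContinuousOn z (Set.Icc 0 T))
    (hz1 : ∀ t ∈ Set.Icc 0 T, ‖z t‖ < 1)
    (hd : ∀ t ∈ Set.Ico 0 T, ∃ i, HasDerivWithinAt z (polyField (G i) (z t)) (Set.Ici t) t)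
    (hs : ‖z 0‖ ≤ s) (hs1 : s < 1) :
    ‖z T‖ ^ 2 ≤
      E * (((1 - s ^ 2)⁻¹) ^ n - 1) * Real.exp (-(2 * (1 - √q) * c) * T) := by
  have hε0 : ∀ k, 0 ≤ ε k := fun k => zero_le_one.trans (hε k)
  have hs0 : 0 ≤ s := (norm_nonneg _).trans hs
  set κ := 2 * (1 - √q) * c
  have hκ : 0 < κ := by
    have : √q < 1 := by rw [Real.sqrt_lt' one_pos]; simpa using hq1
    have : 0 < 1 - √q := by linarith
    positivity
  -- Compactness of [0, T] gives a radius r < 1 containing the curve. It influences the choice of N,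
  -- but not the final bound.
  obtain ⟨t₁, ht₁, hmax⟩ :=
    isCompact_Icc.exists_isMaxOn (Set.nonempty_Icc.2 hT) hz.norm
  set r := ‖z t₁‖
  have hr1 : r < 1 := hz1 t₁ ht₁
  choose! i hi using hd
  have key : ∀ l, ∀ η > 0, ‖z T l‖ ^ 2 ≤
      E * (((1 - s ^ 2)⁻¹) ^ n - 1) * Real.exp (-κ * T) + η := by
    intro l η hη
    -- The error κη is scaled so that Grönwall's inequality turns it into at most η, whatever T is.
    have hrate : ∀ᶠ N in atTop, ∀ i, ∀ w : Fin n → ℂ, (∀ l, ‖w l‖ ≤ r) →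
        lyapunovRate ε N (polyField (G i)) w ≤ -κ * lyapunovSum ε N w + κ * η :=
      eventually_all.2 fun i => eventually_lyapunovRate_le (hG i) hc hq0 hq1.le hε0 hεE (hcpl i)
        (norm_nonneg _) hr1 (mul_pos hκ hη)
    obtain ⟨N, hN, hNl⟩ := (hrate.and (eventually_norm_sq_le_lyapunovSum hε (z T) l)).exists
    have hgr := le_gronwallBound_of_liminf_deriv_right_le (f := fun t => lyapunovSum ε N (z t))
      (f' := fun t => lyapunovRate ε N (polyField (G (i t))) (z t)) (K := -κ) (ε := κ * η)
      (a := 0) (b := T) ((continuous_lyapunovSum ε N).comp_continuousOn hz)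
      (fun t ht r hr => (hasDerivWithinAt_lyapunovSum ε N (hi t ht)).liminf_right_slope_le hr)
      (lyapunovSum_le hε0 hεE hs0 hs1 (fun l => (norm_le_pi_norm _ l).trans hs) N)
      (fun t ht => hN (i t) (z t) fun l =>
        (norm_le_pi_norm _ l).trans (hmax (Set.Ico_subset_Icc_self ht)))
      T ⟨hT, le_rfl⟩
    rw [gronwallBound_of_K_ne_0 (neg_ne_zero.2 hκ.ne')] at hgr
    have h1 : κ * η / -κ * (Real.exp (-κ * (T - 0)) - 1) ≤ η := by
      have : κ * η / -κ = -η := by field_simp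
      rw [this]
      have := mul_pos hη (Real.exp_pos (-κ * (T - 0)))
      linarith
    simp only [sub_zero] at hgr h1
    linarith
  obtain ⟨l, -, hl⟩ := Finset.exists_mem_eq_sup (Finset.univ : Finset (Fin n)) ⟨0, Finset.mem_univ _⟩
    fun l => ‖z T l‖₊
  have hnorm : ‖z T‖ = ‖z T l‖ := by
    rw [Pi.norm_def, hl]
    rfl
  rw [hnorm]
  exact le_of_forall_pos_le_add (key l)

end Decay

/-! ### Back to the original coordinates, and GUAS. -/

section SwitchedSystem

variable {n : ℕ} {ι : Type*}

theorem mem_polydisk_one_iff {z : Fin n → ℂ} : z ∈ polydisk n 1 ↔ ‖z‖ < 1 :=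
  (pi_norm_lt_iff one_pos).symm

theorem locallyLipschitz_polyField (F : Fin n → MvPolynomial (Fin n) ℂ) :
    LocallyLipschitz (polyField F) := by
  have : ContDiff ℂ 1 (polyField F) := by
    refine contDiff_pi.2 fun l => ?_
    simp only [polyField, MvPolynomial.eval_eq']
    fun_prop
  exact this.locallyLipschitz

theorem exists_uniform_isTriangularStable [Finite ι] [NeZero n]
    {F : ι → Fin n → MvPolynomial (Fin n) ℂ}
    (hyp : ∀ i, IsHyperbolicStableZero (F i)) {P : Matrix (Fin n) (Fin n) ℂ}
    (hP : IsTriangularizer (fun i => jacobianZero (F i)) P) :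
    ∃ c, 0 < c ∧ ∀ i, IsTriangularStable c (changeCoords P (F i)) := by
  have hev : ∀ i l, ∀ᶠ c in 𝓝[>] (0 : ℝ), (jacobianZero (changeCoords P (F i)) l l).re ≤ -c := by
    intro i l
    have hneg : (jacobianZero (changeCoords P (F i)) l l).re < 0 := by
      rw [jacobianZero_changeCoords]
      exact (hyp i).2 _ (hasEigenvalue_conj_diag hP.isUnit_det (hP.upper i) l)
    filter_upwards [nhdsWithin_le_nhds (Iio_mem_nhds (neg_pos.2 hneg))] with c hc
    have := Set.mem_Iio.1 hc
    linarith
  obtain ⟨c, hc, hc0⟩ :=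
    ((eventually_all.2 fun i => eventually_all.2 (hev i)).and self_mem_nhdsWithin).exists
  refine ⟨c, hc0, fun i => ⟨?_, fun l q hql => ?_, hc i⟩⟩
  · rw [polyField_changeCoords, Matrix.mulVec_zero, (hyp i).1, Matrix.mulVec_zero]
  · rw [jacobianZero_changeCoords]
    exact hP.upper i l q hql

/-- A value strictly between the supremum and 1 serves as q; finiteness of the index set gives a
common J. -/
theorem exists_couplingRatio_le [Finite ι] [NeZero n] {G : ι → Fin n → MvPolynomial (Fin n) ℂ}
    (h : (⨆ i, limsup (fun j : ℕ => ⨆ k ∈ Finset.Ico 1 j,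
        ENNReal.ofReal (couplingRatio (G i) j k)) atTop) < 1) :
    ∃ q, 0 < q ∧ q < 1 ∧ ∃ J, ∀ i j k, J ≤ j → 1 ≤ k → k < j → couplingRatio (G i) j k ≤ q := by
  obtain ⟨Q, hQ, hQ1⟩ := exists_between h
  have hQtop : Q ≠ ⊤ := (hQ1.trans ENNReal.one_lt_top).ne
  have hev : ∀ᶠ j in atTop, ∀ i, (⨆ k ∈ Finset.Ico 1 j,
      ENNReal.ofReal (couplingRatio (G i) j k)) < Q :=
    eventually_all.2 fun i => eventually_lt_of_limsup_lt ((le_iSup _ i).trans_lt hQ)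
  obtain ⟨J, hJ⟩ := eventually_atTop.1 hev
  refine ⟨Q.toReal, ENNReal.toReal_pos (bot_le.trans_lt hQ).ne' hQtop, ?_, J,
    fun i j k hj hk hkj => ?_⟩
  · rw [← ENNReal.toReal_one]
    exact (ENNReal.toReal_lt_toReal hQtop ENNReal.one_ne_top).2 hQ1
  · rw [← ENNReal.ofReal_le_iff_le_toReal hQtop]
    exact (le_iSup₂ (f := fun k (_ : k ∈ Finset.Ico 1 j) =>
      ENNReal.ofReal (couplingRatio (G i) j k)) k (Finset.mem_Ico.2 ⟨hk, hkj⟩)).trans (hJ j hj i).le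

variable {F : ι → Fin n → MvPolynomial (Fin n) ℂ}

theorem exists_exponential_decay [Finite ι] [NeZero n] (hyp : ∀ i, IsHyperbolicStableZero (F i))
    (hcomp : ∀ i, ∀ x₀ ∈ polydisk n 1, ∃ x : ℝ → Fin n → ℂ,
      IsSolution (polyField (F i)) x ∧ x 0 = x₀)
    (hinv : ∀ i, IsInvariantForward (polyField (F i)) (polydisk n 1))
    {P : Matrix (Fin n) (Fin n) ℂ} (hP : IsTriangularizer (fun i => jacobianZero (F i)) P)
    (h : (⨆ i, limsup (fun j : ℕ => ⨆ k ∈ Finset.Ico 1 j,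
        ENNReal.ofReal (couplingRatio (changeCoords P (F i)) j k)) atTop) < 1) :
    ∃ C κ : ℝ, 0 < κ ∧ ∀ (σ : ℝ → ι) (x : ℝ → Fin n → ℂ), IsCommutationLaw σ →
      IsTrajectory (fun i => polyField (F i)) σ x → ∀ s < 1, ‖x 0‖ ≤ s → ∀ t, 0 ≤ t →
        ‖x t‖ ^ 2 ≤ C * (((1 - s ^ 2)⁻¹) ^ n - 1) * Real.exp (-κ * t) := by
  obtain ⟨c, hc, hG⟩ := exists_uniform_isTriangularStable hyp hP
  obtain ⟨q, hq0, hq1, J, hJ⟩ := exists_couplingRatio_le h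
  obtain ⟨ε, E, hε, hεE, hcpl⟩ := exists_bounded_weights
    (fun i => couplingRatio (changeCoords P (F i))) hq0 J hJ
  have hκ : 0 < 2 * (1 - √q) * c := by
    have : √q < 1 := by rw [Real.sqrt_lt' one_pos]; simpa using hq1
    have : 0 < 1 - √q := by linarith
    positivity
  -- Returning from ẑ to z = Pẑ costs ‖P‖²; passing to ẑ costs nothing because ‖P⁻¹‖ = 1.
  refine ⟨matrixSupNorm P ^ 2 * E, _, hκ, fun σ x hσ hx s hs1 hs t ht => ?_⟩
  have : Nonempty ι := ⟨σ 0⟩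
  have hLip : ∀ i, LocallyLipschitz (polyField (F i)) := fun i => locallyLipschitz_polyField (F i)
  have hPinv : ∀ v, P.mulVec (P⁻¹.mulVec v) = v := fun v => by
    rw [Matrix.mulVec_mulVec, Matrix.mul_nonsing_inv P hP.isUnit_det, Matrix.one_mulVec]
  have hcontr : ∀ v, ‖P⁻¹.mulVec v‖ ≤ ‖v‖ := fun v => by
    simpa [hP.norm_inv] using norm_mulVec_le P⁻¹ v
  -- The longer interval [0, t + 1] is nondegenerate even when t = 0.
  have ht1 : (0 : ℝ) < t + 1 := by linarith
  have hxt : IsTrajectoryOn (fun i => polyField (F i)) σ 0 (t + 1) x :=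
    hx.isTrajectoryOn hσ le_rfl
  have hmem := hxt.mem hLip hσ hcomp hinv le_rfl ht1
    (mem_polydisk_one_iff.2 (hs.trans_lt hs1))
  have key := norm_sq_le_of_isTriangularStable hG hc hq0.le hq1 hε hεE hcpl
    (z := fun t => P⁻¹.mulVec (x t)) ht
    ((by fun_prop : Continuous fun v => P⁻¹.mulVec v).comp_continuousOn
      (hx.1.mono fun u hu => hu.1))
    (fun u hu => (hcontr _).trans_lt (mem_polydisk_one_iff.1
      (hmem u ⟨hu.1, hu.2.trans (by linarith)⟩)))
    (fun u hu => by
      obtain ⟨i, hi⟩ := hσ.exists_eventually_right_eq hu.1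
      have hd := hxt.hasDerivWithinAt_Ici (hLip i).continuous hu.1
        (hu.2.trans (lt_add_one t)) hi
      refine ⟨i, ?_⟩
      rw [polyField_changeCoords, hPinv]
      exact (((LinearMap.toContinuousLinearMap (P⁻¹.mulVecLin)).restrictScalars
        ℝ).hasFDerivAt.comp_hasDerivWithinAt u hd))
    ((hcontr _).trans hs) hs1
  calc ‖x t‖ ^ 2 = ‖P.mulVec (P⁻¹.mulVec (x t))‖ ^ 2 := by rw [hPinv]
    _ ≤ (matrixSupNorm P * ‖P⁻¹.mulVec (x t)‖) ^ 2 :=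
      pow_le_pow_left₀ (norm_nonneg _) (norm_mulVec_le _ _) 2
    _ = matrixSupNorm P ^ 2 * ‖P⁻¹.mulVec (x t)‖ ^ 2 := mul_pow _ _ _
    _ ≤ matrixSupNorm P ^ 2 * (E * (((1 - s ^ 2)⁻¹) ^ n - 1) *
        Real.exp (-(2 * (1 - √q) * c) * t)) := mul_le_mul_of_nonneg_left key (sq_nonneg _)
    _ = _ := by ring

theorem isGUAS_of_exponential_decay (hF : ∀ i, polyField (F i) 0 = 0)
    (hcomp : ∀ i, ∀ x₀ ∈ polydisk n 1, ∃ x : ℝ → Fin n → ℂ,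
      IsSolution (polyField (F i)) x ∧ x 0 = x₀)
    (hinv : ∀ i, IsInvariantForward (polyField (F i)) (polydisk n 1)) {C κ : ℝ} (hκ : 0 < κ)
    (h : ∀ (σ : ℝ → ι) (x : ℝ → Fin n → ℂ), IsCommutationLaw σ →
      IsTrajectory (fun i => polyField (F i)) σ x → ∀ s < 1, ‖x 0‖ ≤ s → ∀ t, 0 ≤ t →
        ‖x t‖ ^ 2 ≤ C * (((1 - s ^ 2)⁻¹) ^ n - 1) * Real.exp (-κ * t)) :
    IsGUAS (fun i => polyField (F i)) 0 (polydisk n 1) := by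
  refine ⟨hF, fun σ hσ x₀ hx₀ => exists_isTrajectory
    (fun i => locallyLipschitz_polyField (F i)) hσ hcomp hinv hx₀, fun e he => ?_,
    fun σ x hσ hx h0 =>
      tendsto_zero_of_norm_sq_le_exp hκ (h σ x hσ hx _ (mem_polydisk_one_iff.1 h0) le_rfl)⟩
  -- The prefactor vanishes at s = 0 and is continuous there, so a small δ gives uniform stability.
  have hcont : ContinuousAt (fun s : ℝ => C * (((1 - s ^ 2)⁻¹) ^ n - 1)) 0 := by
    refine ContinuousAt.mul continuousAt_const (ContinuousAt.sub (ContinuousAt.pow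
      (ContinuousAt.inv₀ (by fun_prop) (by norm_num)) n) continuousAt_const)
  have hev : ∀ᶠ s in 𝓝[>] (0 : ℝ), C * (((1 - s ^ 2)⁻¹) ^ n - 1) < e ^ 2 :=
    nhdsWithin_le_nhds (hcont.eventually_lt_const (by simpa using pow_pos he 2))
  obtain ⟨δ, hδ, hδ0, hδ1⟩ := (hev.and (Ioo_mem_nhdsGT one_pos)).exists
  refine ⟨δ, hδ0, fun σ x hσ hx h0 t ht => ?_, fun σ x hσ hx h0 => ?_⟩
  · rw [sub_zero] at h0 ⊢
    refine le_of_sq_le_sq ?_ he.le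
    have hx2 := h σ x hσ hx δ hδ1 h0 t ht.le
    have hexp : Real.exp (-κ * t) ≤ 1 := Real.exp_le_one_iff.2 (by nlinarith)
    -- The sign of C is not known at this point.
    rcases le_or_gt 0 (C * (((1 - δ ^ 2)⁻¹) ^ n - 1)) with hB | hB
    · nlinarith [mul_le_mul_of_nonneg_left hexp hB]
    · have := mul_neg_of_neg_of_pos hB (Real.exp_pos (-κ * t))
      nlinarith [sq_nonneg e]
  · rw [sub_zero] at h0
    exact tendsto_zero_of_norm_sq_le_exp hκ (h σ x hσ hx δ hδ1 h0)

end SwitchedSystem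
end

theorem mainTheorem2 {n m : ℕ} [NeZero n] (F : Fin m → Fin n → MvPolynomial (Fin n) ℂ)
    (hyp : ∀ i, IsHyperbolicStableZero (F i))
    (hGAS : ∀ i, IsGloballyAsymptoticallyStable (polyField (F i)) 0 (polydisk n 1))
    (hsolv : GeneratesSolvable fun i => jacobianZero (F i))
    (hinv : ∀ i, IsInvariantForward (polyField (F i)) (polydisk n 1)) :
    (∃ P : Matrix (Fin n) (Fin n) ℂ, IsTriangularizer (fun i => jacobianZero (F i)) P) ∧
    ∀ P : Matrix (Fin n) (Fin n) ℂ, IsTriangularizer (fun i => jacobianZero (F i)) P →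
      (⨆ i : Fin m, limsup (fun j : ℕ => ⨆ k ∈ Finset.Ico 1 j,
        ENNReal.ofReal (couplingRatio (changeCoords P (F i)) j k)) atTop) < 1 →
      IsGUAS (fun i => polyField (F i)) 0 (polydisk n 1) := by
  refine ⟨exists_isTriangularizer hsolv, fun P hP h => ?_⟩
  obtain ⟨C, κ, hκ, hdecay⟩ :=
    exists_exponential_decay hyp (fun i => (hGAS i).complete) hinv hP h
  exact isGUAS_of_exponential_decay (fun i => (hyp i).1) (fun i => (hGAS i).complete) hinv hκ
    hdecay
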